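/- Let $(S,\mathcal A,P)$ and $(\Omega,\mathcal F,\mathbb P)$ be probability spaces with expectations $E$ and $\mathbb E$. Let $\{c(t,x):t\ge 0,\ x\in\mathbb R\}$ be a jointly measurable, uniformly bounded, strictly stationary random field on $(S,\mathcal A,P)$ with $E\,c(t,x)=0$ for all $t\ge 0$, $x\in\mathbb R$, and let $\{B_t:t\ge 0\}$ be a standard Brownian motion on $(\Omega,\mathcal F,\mathbb P)$. Put $\Phi(t,x)=E[c(s,y)\,c(s+t,y+x)]$ for $t\ge0$, $x\in\mathbb R$, which does not depend on $s\ge 0$, $y\in\mathbb R$. For $A\subset\mathbb R_+\times\mathbb R$ let $\mathcal F_A=\sigma\{c(t,x):(t,x)\in A\}$, and for $r\ge0$ let $$\alpha_{\rm um}(r)=\sup\bigl\{|P(S_1\mid S_2)-P(S_1)|:\ A_1,A_2\subset\mathbb R_+\times\mathbb R,\ \operatorname{dist}(A_1,A_2)\ge r,\ S_1\in\mathcal F_{A_1},\ S_2\in\mathcal F_{A_2},\ P(S_2)\neq0\bigr\},$$ where $\operatorname{dist}$ is the Euclidean distance. Assume $(H_{\rm um})$: there are $C,\delta>0$ such that $\alpha_{\rm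 um}(r)\le C(1+r)^{-(2+\delta)}$ for all $r\ge 0$. For $0\le\beta\le 1/2$, $t\ge 0$, $x\in\mathbb R$ and $\varepsilon>0$ let, on the product space $(\Omega\times S,\ \mathbb P\times P)$, $$Y_t^{\varepsilon,x}=\frac1{\sqrt\varepsilon}\int_0^t c\Bigl(\frac s\varepsilon,\frac{x+B_s}{\varepsilon^\beta}\Bigr)\,ds .$$ Then for all $0\le\beta\le1/2$, $t\ge0$ and $x\in\mathbb R$, $$\lim_{\varepsilon\to0^+}E\exp(Y_t^{\varepsilon,x})=\exp\bigl(t\,\Sigma(\beta)\bigr)\quad\text{in }\mathbb P\text{-probability},$$ where $$\Sigma(\beta)=\begin{cases}\displaystyle\int_0^{\infty}\Phi(u,0)\,du,&0\le\beta<1/2,\\[2mm]\displaystyle\int_0^{\infty}\mathbb E\,\Phi(u,B_u)\,du,&\beta=1/2,\end{cases}$$ and these integrals converge absolutely. -/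

import Mathlib

open MeasureTheory ProbabilityTheory Filter Topology Set
open scoped NNReal ENNReal

namespace RandomPotential

variable {S Ω : Type*} [MeasurableSpace S] [MeasurableSpace Ω]

/-- Strict stationarity of a random field `c(t, x)`, `t ≥ 0`, `x ∈ ℝ`: the shifted field
`(t, x) ↦ c(t + h, x + y)` has the same law (on the product σ-algebra, that is, the same
finite-dimensional distributions) as `c`, for all `h ≥ 0` and `y ∈ ℝ`. -/
def Stationary (P : Measure S) (c : ℝ≥0 → ℝ → S → ℝ) : Prop :=
  ∀ (h : ℝ≥0) (y : ℝ),
    Measure.map (fun (s : S) (p : ℝ≥0 × ℝ) => c (p.1 + h) (p.2 + y) s) P =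
      Measure.map (fun (s : S) (p : ℝ≥0 × ℝ) => c p.1 p.2 s) P

/-- The σ-algebra generated by the random variables `c(t, x)`, `(t, x) ∈ A`. -/
@[reducible]
def sigmaField (c : ℝ≥0 → ℝ → S → ℝ) (A : Set (ℝ≥0 × ℝ)) : MeasurableSpace S :=
  ⨆ p ∈ A, MeasurableSpace.comap (c p.1 p.2) inferInstance

/-- `dist(A₁, A₂) ≥ r` for the Euclidean distance of the half-plane. -/
def FarApart (A₁ A₂ : Set (ℝ≥0 × ℝ)) (r : ℝ) : Prop :=
  ∀ p ∈ A₁, ∀ q ∈ A₂, r ≤ √(((p.1 : ℝ) - (q.1 : ℝ)) ^ 2 + (p.2 - q.2) ^ 2)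

/-- The numbers `|P(S₁ | S₂) - P(S₁)|` whose supremum is the uniform mixing coefficient. -/
def mixingDefects (P : Measure S) (c : ℝ≥0 → ℝ → S → ℝ) (r : ℝ) : Set ℝ :=
  {a | ∃ A₁ A₂ : Set (ℝ≥0 × ℝ), FarApart A₁ A₂ r ∧
    ∃ S₁ S₂ : Set S, MeasurableSet[sigmaField c A₁] S₁ ∧ MeasurableSet[sigmaField c A₂] S₂ ∧
      P S₂ ≠ 0 ∧ a = |(cond P S₂).real S₁ - P.real S₁|}

/-- The uniform mixing coefficient of the random field `c`. -/
noncomputable def alphaUm (P : Measure S) (c : ℝ≥0 → ℝ → S → ℝ) (r : ℝ) : ℝ :=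
  sSup (mixingDefects P c r)

/-- The supremum defining the uniform mixing coefficient is over a bounded set. -/
theorem bddAbove_mixingDefects (P : Measure S) [IsProbabilityMeasure P]
    (c : ℝ≥0 → ℝ → S → ℝ) (r : ℝ) : BddAbove (mixingDefects P c r) := by
  refine ⟨1, ?_⟩
  rintro a ⟨A₁, A₂, -, S₁, S₂, -, -, h0, rfl⟩
  have : IsProbabilityMeasure (cond P S₂) := cond_isProbabilityMeasure h0
  have h1 : (cond P S₂).real S₁ ≤ 1 := measureReal_le_one
  have h2 : P.real S₁ ≤ 1 := measureReal_le_one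
  have h3 : 0 ≤ (cond P S₂).real S₁ := measureReal_nonneg
  have h4 : 0 ≤ P.real S₁ := measureReal_nonneg
  rw [abs_le]
  constructor <;> linarith

/-- The set of mixing defects is nonempty (it contains `0`). -/
theorem zero_mem_mixingDefects (P : Measure S) [IsProbabilityMeasure P]
    (c : ℝ≥0 → ℝ → S → ℝ) (r : ℝ) : (0 : ℝ) ∈ mixingDefects P c r := by
  refine ⟨∅, ∅, fun p hp => absurd hp (by simp), ∅, univ,
    @MeasurableSet.empty _ (sigmaField c ∅), @MeasurableSet.univ _ (sigmaField c ∅),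
    by simp, by simp⟩

/-- The condition `(H_um)`: `α_um(r) ≤ C (1 + r)^{-(2+δ)}` for some `C, δ > 0`. -/
def HUm (P : Measure S) (c : ℝ≥0 → ℝ → S → ℝ) : Prop :=
  ∃ C δ : ℝ, 0 < C ∧ 0 < δ ∧ ∀ r : ℝ, 0 ≤ r → alphaUm P c r ≤ C * (1 + r) ^ (-(2 + δ))

/-- The correlation function `Φ(t, x) = E[c(0, 0) c(t, x)]`, `t ≥ 0`; for a stationary field it
equals `E[c(s, y) c(s + t, y + x)]` for all `s ≥ 0` and `y`. -/
noncomputable def corr (P : Measure S) (c : ℝ≥0 → ℝ → S → ℝ) (t : ℝ≥0) (x : ℝ) : ℝ :=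
  ∫ s, c 0 0 s * c t x s ∂P

/-- The exponent of the Feynman–Kac formula,
`Y_t^{ε,x} = ε^{-1/2} ∫_0^t c(s / ε, (x + B_s) / ε^β) ds`,
a function of the point `ω` of the Brownian space and of the point `σ` of the space of `c`. -/
noncomputable def exponent (c : ℝ≥0 → ℝ → S → ℝ) (B : ℝ≥0 → Ω → ℝ) (β : ℝ) (t : ℝ≥0) (x : ℝ)
    (ε : ℝ) (ω : Ω) (σ : S) : ℝ :=
  (√ε)⁻¹ * ∫ s in (0 : ℝ)..t, c (s / ε).toNNReal ((x + B s.toNNReal ω) / ε ^ β) σ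

/-- The integrand of `Σ(β)` at time `u`: `Φ(u, 0)` if `β < 1/2`, and `𝔼 Φ(u, B_u)` otherwise. -/
noncomputable def sigmaIntegrand (P : Measure S) (Q : Measure Ω) (c : ℝ≥0 → ℝ → S → ℝ)
    (B : ℝ≥0 → Ω → ℝ) (β : ℝ) (u : ℝ) : ℝ :=
  if β < 1 / 2 then corr P c u.toNNReal 0
  else ∫ ω, corr P c u.toNNReal (B u.toNNReal ω) ∂Q

/-- The limiting constant `Σ(β)`. -/
noncomputable def sigmaConst (P : Measure S) (Q : Measure Ω) (c : ℝ≥0 → ℝ → S → ℝ)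
    (B : ℝ≥0 → Ω → ℝ) (β : ℝ) : ℝ :=
  ∫ u in Ioi (0 : ℝ), sigmaIntegrand P Q c B β u

end RandomPotential

/-!
Fix the Brownian path. In the time scale of the field the exponent is `∫₀ᵀ W` with `T = t / ε` and
`W r = √ε c(r, X r)`, where `X` is the rescaled path. The points of the space-time graph of `X` at
times `u` apart are at distance at least `u`, so `W` mixes at the rate `α_um`, whatever `X` is.

For such a bounded, weakly dependent process write `I r = ∫₀ʳ W` and `M r = E exp(I r)`. Expanding
the exponential to second order gives
`M τ = 1 + ∫₀^τ E[W r] dr + ∫₀^τ E[exp(I r) W r ∫ᵣ^τ W] dr`. Replacing `exp(I r)` by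
`exp(I (r - L))` costs little because `W` is small, and then mixing across the gap `L` factors the
expectation. So `M` nearly solves `M' = ρ M`, where `ρ r = ∫₀^∞ E[W r W (r + u)] du`, and Grönwall's
inequality compares `M T` with `exp(∫₀ᵀ ρ)`. The gap `L = ε ^ (-1/4)` makes the error tend to `0`,
uniformly in the path.

By stationarity `∫₀ᵀ ρ = ∫₀ᵗ ∫₀^∞ Φ(u, (B (r + ε u) - B r) / ε ^ β) du dr`. If `β < 1/2` the
rescaled increments tend to `0` and `Φ(u, ·)` is continuous at `0` after averaging. If `β = 1/2`
they have the law of `B u`, and are independent for times `r` more than `ε u` apart, so that the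
average over `r` concentrates at its mean. Either way this double integral converges in `L¹` to
`t Σ(β)`.
-/

namespace RandomPotential

theorem absolutelyContinuousOnInterval_comp {X Y : Type*} [PseudoMetricSpace X]
    [PseudoMetricSpace Y] {φ : X → Y} {f : ℝ → X} {s : Set X} {K : ℝ≥0} {a b : ℝ}
    (hφ : LipschitzOnWith K φ s) (hf : AbsolutelyContinuousOnInterval f a b)
    (hfs : MapsTo f (uIcc a b) s) : AbsolutelyContinuousOnInterval (φ ∘ f) a b := by
  rw [absolutelyContinuousOnInterval_iff] at hf ⊢
  intro ε hε
  obtain ⟨δ, hδ, hsum⟩ := hf (ε / (K + 1)) (by positivity)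
  refine ⟨δ, hδ, fun E hE hlen => ?_⟩
  calc ∑ i ∈ Finset.range E.1, dist (φ (f (E.2 i).1)) (φ (f (E.2 i).2))
      ≤ ∑ i ∈ Finset.range E.1, (K + 1) * dist (f (E.2 i).1) (f (E.2 i).2) := by
        refine Finset.sum_le_sum fun i hi => ?_
        refine (hφ.dist_le_mul _ (hfs (hE.1 i hi).1) _ (hfs (hE.1 i hi).2)).trans ?_
        gcongr
        linarith
    _ < ε := by
        rw [← Finset.mul_sum]
        have := hsum E hE hlen
        rwa [lt_div_iff₀ (by positivity), mul_comm] at this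

theorem integral_deriv_comp_primitive_mul {φ : ℝ → ℝ} (hφ : ContDiff ℝ 1 φ) {v : ℝ → ℝ} {a b : ℝ}
    (hv : IntervalIntegrable v volume a b) :
    ∫ r in a..b, deriv φ (∫ s in a..r, v s) * v r = φ (∫ s in a..b, v s) - φ 0 := by
  have hprim := hv.absolutelyContinuousOnInterval_intervalIntegral (c := a) left_mem_uIcc
  have hcompact := isCompact_uIcc.image_of_continuousOn hprim.continuousOn
  obtain ⟨R, hR⟩ := hcompact.isBounded.subset_closedBall 0
  obtain ⟨K, hK⟩ := hφ.contDiffOn.exists_lipschitzOnWith one_ne_zero (convex_closedBall 0 R)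
    (isCompact_closedBall 0 R)
  have hFTC := (absolutelyContinuousOnInterval_comp hK hprim
    (mapsTo_iff_image_subset.2 hR)).integral_deriv_eq_sub
  rw [Function.comp_apply, Function.comp_apply, intervalIntegral.integral_same] at hFTC
  rw [← hFTC]
  refine intervalIntegral.integral_congr_ae ?_
  filter_upwards [hv.ae_hasDerivAt_integral] with r hr hrab
  have hφr := (hφ.differentiable one_ne_zero (∫ s in a..r, v s)).hasDerivAt
  exact ((hφr.comp r (hr (uIoc_subset_uIcc hrab) a left_mem_uIcc)).deriv).symm

theorem exp_primitive_eq {v : ℝ → ℝ} {a b : ℝ} (hv : IntervalIntegrable v volume a b) :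
    Real.exp (∫ s in a..b, v s) = 1 + ∫ r in a..b, Real.exp (∫ s in a..r, v s) * v r := by
  have h := integral_deriv_comp_primitive_mul Real.contDiff_exp hv
  rw [Real.deriv_exp, Real.exp_zero] at h
  linarith

-- Apply the chain rule to `φ z = exp z * (1 + Z - z)`, `Z` being the full integral.
theorem exp_primitive_eq_second_order {v : ℝ → ℝ} {a b : ℝ}
    (hv : IntervalIntegrable v volume a b) :
    Real.exp (∫ s in a..b, v s) = 1 + (∫ s in a..b, v s) +
      ∫ r in a..b, Real.exp (∫ s in a..r, v s) * (v r * ∫ s in r..b, v s) := by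
  set Z := ∫ s in a..b, v s
  have hφ' : ∀ z, HasDerivAt (fun z => Real.exp z * (1 + Z - z)) (Real.exp z * (Z - z)) z :=
    fun z => ((Real.hasDerivAt_exp z).mul ((hasDerivAt_id' z).const_sub (1 + Z))).congr_deriv
      (by ring)
  have h := integral_deriv_comp_primitive_mul
    (φ := fun z => Real.exp z * (1 + Z - z)) (by fun_prop) hv
  rw [funext fun z => (hφ' z).deriv] at h
  have hcongr : ∫ r in a..b, Real.exp (∫ s in a..r, v s) * (v r * ∫ s in r..b, v s) =
      ∫ r in a..b, Real.exp (∫ s in a..r, v s) * (Z - ∫ s in a..r, v s) * v r := by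
    refine intervalIntegral.integral_congr fun r hr => ?_
    have har : IntervalIntegrable v volume a r := hv.mono_set (uIcc_subset_uIcc_left hr)
    simp only [Z]
    rw [intervalIntegral.integral_interval_sub_left hv har]
    ring
  rw [hcongr, h, add_sub_cancel_right, Real.exp_zero]
  ring

theorem le_mul_exp_of_le_add_integral {f : ℝ → ℝ} {a b A C : ℝ} (hf : ContinuousOn f (Icc a b))
    (hC : 0 ≤ C) (h : ∀ τ ∈ Icc a b, f τ ≤ A + C * ∫ r in a..τ, f r) {τ : ℝ} (hτ : τ ∈ Icc a b) :
    f τ ≤ A * Real.exp (C * (τ - a)) := by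
  have hab : a ≤ b := hτ.1.trans hτ.2
  have hint : IntervalIntegrable f volume a b := hf.intervalIntegrable_of_Icc hab
  have hcont : ContinuousOn (fun x => A + C * ∫ r in a..x, f r) (Icc a b) := by
    have := intervalIntegral.continuousOn_primitive_interval' hint left_mem_uIcc
    rw [uIcc_of_le hab] at this
    fun_prop
  have hderiv : ∀ x ∈ Ico a b,
      HasDerivWithinAt (fun x => A + C * ∫ r in a..x, f r) (C * f x) (Ici x) x := by
    intro x hx
    refine ((intervalIntegral.integral_hasDerivWithinAt_right (s := Ici x) (t := Ioi x)
      (hint.mono_set ?_) ?_ ?_).const_mul C).const_add A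
    · rw [uIcc_of_le hx.1, uIcc_of_le hab]
      exact Icc_subset_Icc_right hx.2.le
    · exact ⟨Ioc x b, Ioc_mem_nhdsGT hx.2, ((hf.mono fun y hy =>
        ⟨hx.1.trans hy.1.le, hy.2⟩).aestronglyMeasurable measurableSet_Ioc)⟩
    · exact ((hf x (Ico_subset_Icc_self hx)).mono_of_mem_nhdsWithin
        (mem_of_superset (Ioc_mem_nhdsGT hx.2) fun y hy => ⟨hx.1.trans hy.1.le, hy.2⟩))
  have hgron := le_gronwallBound_of_liminf_deriv_right_le (f' := fun x => C * f x) (δ := A)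
    (K := C) (ε := 0) hcont (fun x hx r hr => (hderiv x hx).liminf_right_slope_le hr)
    (by simp) (fun x hx => by
      rw [add_zero]; exact mul_le_mul_of_nonneg_left (h x (Ico_subset_Icc_self hx)) hC) τ hτ
  rw [gronwallBound_ε0] at hgron
  exact (h τ hτ).trans hgron

theorem abs_exp_sub_one_le (x : ℝ) : |Real.exp x - 1| ≤ Real.exp |x| - 1 := by
  rcases le_total 0 x with hx | hx
  · rw [abs_of_nonneg hx, abs_of_nonneg (sub_nonneg.2 (Real.one_le_exp hx))]
  · have hinv : Real.exp x * Real.exp (-x) = 1 := by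
      rw [← Real.exp_add, add_neg_cancel, Real.exp_zero]
    rw [abs_of_nonpos hx, abs_of_nonpos (sub_nonpos.2 (Real.exp_le_one_iff.2 hx))]
    nlinarith [Real.exp_pos x, sq_nonneg (Real.exp x - 1), sq_nonneg (Real.exp (-x) - 1)]

theorem abs_integral_le_of_abs_le {α : Type*} [MeasurableSpace α] {μ : Measure α} {f g : α → ℝ}
    (hg : Integrable g μ) (h : ∀ᵐ a ∂μ, |f a| ≤ g a) : |∫ a, f a ∂μ| ≤ ∫ a, g a ∂μ :=
  norm_integral_le_of_norm_le (f := f) hg h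

theorem abs_integral_le_of_abs_le_const {α : Type*} [MeasurableSpace α] {μ : Measure α}
    [IsProbabilityMeasure μ] {f : α → ℝ} {C : ℝ} (h : ∀ a, |f a| ≤ C) : |∫ a, f a ∂μ| ≤ C := by
  simpa using norm_integral_le_of_norm_le_const (μ := μ) (f := f) (Eventually.of_forall h)

theorem abs_intervalIntegral_le_of_abs_le {f g : ℝ → ℝ} {a b : ℝ} (hab : a ≤ b)
    (hg : IntervalIntegrable g volume a b) (h : ∀ r ∈ Ioc a b, |f r| ≤ g r) :
    |∫ r in a..b, f r| ≤ ∫ r in a..b, g r :=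
  intervalIntegral.norm_integral_le_of_norm_le (f := f) hab (Eventually.of_forall h) hg

theorem abs_intervalIntegral_le_setIntegral_Ioi {f g : ℝ → ℝ} {a b : ℝ} (hab : a ≤ b)
    (hg : IntegrableOn g (Ioi a)) (hg0 : ∀ r ∈ Ioi a, 0 ≤ g r) (h : ∀ r ∈ Ioc a b, |f r| ≤ g r) :
    |∫ r in a..b, f r| ≤ ∫ r in Ioi a, g r := by
  have hgb : IntegrableOn g (Ioc a b) := hg.mono_set Ioc_subset_Ioi_self
  refine (abs_intervalIntegral_le_of_abs_le hab
    ((intervalIntegrable_iff_integrableOn_Ioc_of_le hab).2 hgb) h).trans ?_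
  rw [intervalIntegral.integral_of_le hab]
  exact setIntegral_mono_set hg ((ae_restrict_iff' measurableSet_Ioi).2 (Eventually.of_forall hg0))
    Ioc_subset_Ioi_self.eventuallyLE

theorem integral_intervalIntegral_swap {S : Type*} [MeasurableSpace S] {P : Measure S}
    [IsFiniteMeasure P] {f : ℝ → S → ℝ} (hf : Measurable (Function.uncurry f)) {a b C : ℝ}
    (hab : a ≤ b) (hC : ∀ r ∈ Ioc a b, ∀ s, |f r s| ≤ C) :
    ∫ s, (∫ r in a..b, f r s) ∂P = ∫ r in a..b, (∫ s, f r s ∂P) := by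
  simp only [intervalIntegral.integral_of_le hab]
  refine integral_integral_swap (f := fun s r => f r s)
    (.of_bound (hf.comp measurable_swap).aestronglyMeasurable C ?_)
  filter_upwards [Measure.quasiMeasurePreserving_snd.ae (ae_restrict_mem measurableSet_Ioc)]
    with p hp using hC p.2 hp p.1

theorem antitoneOn_setIntegral_Ioi {θ : ℝ → ℝ} {a : ℝ} (hθ : IntegrableOn θ (Ioi a))
    (hθ0 : ∀ u ∈ Ioi a, 0 ≤ θ u) : AntitoneOn (fun r => ∫ u in Ioi r, θ u) (Ici a) := by
  intro r hr r' _ hrr'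
  refine setIntegral_mono_set (hθ.mono_set (Ioi_subset_Ioi hr)) ?_
    (Ioi_subset_Ioi hrr').eventuallyLE
  exact (ae_restrict_iff' measurableSet_Ioi).2
    (Eventually.of_forall fun u hu => hθ0 u (lt_of_le_of_lt (mem_Ici.1 hr) (mem_Ioi.1 hu)))

section WeakDependence

variable {S : Type*} {W : ℝ → S → ℝ}

/-- The integral `∫₀ʳ W` of the process `W`. -/
noncomputable def primitive (W : ℝ → S → ℝ) (r : ℝ) (s : S) : ℝ :=
  ∫ a in (0 : ℝ)..r, W a s

@[simp]
theorem primitive_zero (s : S) : primitive W 0 s = 0 := intervalIntegral.integral_same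

variable [MeasurableSpace S] {P : Measure S} {K : ℝ}

/-- A jointly measurable real process, indexed by the real line and bounded by `K`. Time runs over
`ℝ` rather than `ℝ≥0` so that interval integrals apply; the conditions on the law of the process
are imposed only at nonnegative times. -/
structure IsBoundedProcess (W : ℝ → S → ℝ) (K : ℝ) : Prop where
  measurable : Measurable (Function.uncurry W)
  abs_le : ∀ r s, |W r s| ≤ K

/-- The exponential moment `E exp(∫₀ʳ W)`. -/
noncomputable def expMoment (P : Measure S) (W : ℝ → S → ℝ) (r : ℝ) : ℝ :=
  ∫ s, Real.exp (primitive W r s) ∂P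

/-- The covariance of a centred process `W` between the times `r` and `r + u`. -/
noncomputable def lagCov (P : Measure S) (W : ℝ → S → ℝ) (r u : ℝ) : ℝ :=
  ∫ s, W r s * W (r + u) s ∂P

/-- The covariance of `W` between the times `r` and `r + u` under the measure with density
`exp(∫₀ᵍ W)`, which is not normalized: comparing it with `expMoment P W g * lagCov P W r u`
measures the dependence of the future on the past of `W`. -/
noncomputable def tiltedLagCov (P : Measure S) (W : ℝ → S → ℝ) (g r u : ℝ) : ℝ :=
  ∫ s, Real.exp (primitive W g s) * (W r s * W (r + u) s) ∂P

/-- The covariance of `W r` with the increment `∫ᵣ^τ W` under the measure with density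
`exp(∫₀ʳ W)`; its integral over `r` is the second-order term of the expansion of
`expMoment P W τ`. -/
noncomputable def incrementCov (P : Measure S) (W : ℝ → S → ℝ) (τ r : ℝ) : ℝ :=
  ∫ s, Real.exp (primitive W r s) * (W r s * ∫ a in r..τ, W a s) ∂P

/-- The covariances of `W r` with the future of `W`, integrated over the lag. When `W` is stationary
this is half of the asymptotic rate of growth of the variance of `∫₀ʳ W`. -/
noncomputable def lagRate (P : Measure S) (W : ℝ → S → ℝ) (r : ℝ) : ℝ :=
  ∫ u in Ioi (0 : ℝ), lagCov P W r u

@[simp]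
theorem tiltedLagCov_zero_left (r u : ℝ) : tiltedLagCov P W 0 r u = lagCov P W r u := by
  simp [tiltedLagCov, lagCov]

@[simp]
theorem expMoment_zero [IsProbabilityMeasure P] : expMoment P W 0 = 1 := by simp [expMoment]

theorem stronglyMeasurable_lagCov [SFinite P] (hW : Measurable (Function.uncurry W)) :
    StronglyMeasurable (Function.uncurry (lagCov P W)) :=
  ((hW.comp (by fun_prop : Measurable fun p : (ℝ × ℝ) × S => (p.1.1, p.2))).mul
    (hW.comp (by fun_prop : Measurable fun p : (ℝ × ℝ) × S =>
      (p.1.1 + p.1.2, p.2)))).stronglyMeasurable.integral_prod_right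

namespace IsBoundedProcess

theorem measurable_apply (h : IsBoundedProcess W K) (r : ℝ) : Measurable (W r) :=
  h.measurable.comp measurable_prodMk_left

theorem bound_nonneg [Nonempty S] (h : IsBoundedProcess W K) : 0 ≤ K :=
  (abs_nonneg _).trans (h.abs_le 0 (Classical.arbitrary S))

theorem abs_mul_le (h : IsBoundedProcess W K) (r a : ℝ) (s : S) : |W r s * W a s| ≤ K * K := by
  rw [abs_mul]
  exact mul_le_mul (h.abs_le r s) (h.abs_le a s) (abs_nonneg _)
    ((abs_nonneg _).trans (h.abs_le r s))

theorem intervalIntegrable (h : IsBoundedProcess W K) (s : S) (a b : ℝ) :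
    IntervalIntegrable (fun r => W r s) volume a b :=
  intervalIntegrable_iff.2 (Measure.integrableOn_of_bounded (M := K) (by simp)
    (h.measurable.comp measurable_prodMk_right).aestronglyMeasurable
    (Eventually.of_forall fun r => h.abs_le r s))

theorem integral_eq_primitive_sub (h : IsBoundedProcess W K) (a b : ℝ) (s : S) :
    ∫ r in a..b, W r s = primitive W b s - primitive W a s :=
  (intervalIntegral.integral_interval_sub_left
    (h.intervalIntegrable s _ _) (h.intervalIntegrable s _ _)).symm

theorem abs_integral_le (h : IsBoundedProcess W K) (a b : ℝ) (s : S) :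
    |∫ r in a..b, W r s| ≤ K * |b - a| :=
  intervalIntegral.norm_integral_le_of_norm_le_const (f := fun r => W r s) fun r _ => h.abs_le r s

theorem abs_primitive_le (h : IsBoundedProcess W K) (b : ℝ) (s : S) :
    |primitive W b s| ≤ K * |b| := by
  simpa [primitive] using h.abs_integral_le 0 b s

theorem continuous_primitive (h : IsBoundedProcess W K) (s : S) :
    Continuous fun r => primitive W r s :=
  intervalIntegral.continuous_primitive (h.intervalIntegrable s) 0

theorem measurable_primitive (h : IsBoundedProcess W K) :
    Measurable (Function.uncurry (primitive W)) := by
  refine measurable_uncurry_of_continuous_of_measurable (u := primitive W)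
    h.continuous_primitive fun r => ?_
  have hs : StronglyMeasurable (Function.uncurry fun (s : S) (a : ℝ) => W a s) :=
    (h.measurable.comp measurable_swap).stronglyMeasurable
  exact hs.integral_prod_right.measurable.sub hs.integral_prod_right.measurable

theorem measurable_primitive_apply (h : IsBoundedProcess W K) (r : ℝ) :
    Measurable (primitive W r) :=
  h.measurable_primitive.comp measurable_prodMk_left

theorem exp_primitive_mul_bound (h : IsBoundedProcess W K) (r : ℝ) {f C : ℝ} (hC : |f| ≤ C)
    (s : S) : |Real.exp (primitive W r s) * f| ≤ Real.exp (K * |r|) * C := by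
  rw [abs_mul, Real.abs_exp]
  gcongr
  exact (le_abs_self _).trans (h.abs_primitive_le r s)

theorem integrable_exp_primitive_mul [IsFiniteMeasure P] (h : IsBoundedProcess W K) (r : ℝ)
    {f : S → ℝ} (hf : Measurable f) {C : ℝ} (hC : ∀ s, |f s| ≤ C) :
    Integrable (fun s => Real.exp (primitive W r s) * f s) P :=
  .of_bound ((h.measurable_primitive_apply r).exp.mul hf).aestronglyMeasurable
    (Real.exp (K * |r|) * C) (Eventually.of_forall fun s => h.exp_primitive_mul_bound r (hC s) s)

theorem integrable_exp_primitive [IsFiniteMeasure P] (h : IsBoundedProcess W K) (r : ℝ) :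
    Integrable (fun s => Real.exp (primitive W r s)) P := by
  simpa using h.integrable_exp_primitive_mul (P := P) r (f := fun _ => 1) measurable_const
    (C := 1) (by simp)

theorem integrable_primitive [IsFiniteMeasure P] (h : IsBoundedProcess W K) (r : ℝ) :
    Integrable (primitive W r) P :=
  .of_bound (h.measurable_primitive_apply r).aestronglyMeasurable (K * |r|)
    (Eventually.of_forall (h.abs_primitive_le r))

variable [IsProbabilityMeasure P]

theorem expMoment_pos (h : IsBoundedProcess W K) (r : ℝ) : 0 < expMoment P W r :=
  integral_exp_pos (h.integrable_exp_primitive r)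

theorem continuous_expMoment (h : IsBoundedProcess W K) : Continuous (expMoment P W) := by
  refine continuous_iff_continuousAt.2 fun r => continuousAt_of_dominated
    (bound := fun _ => Real.exp (K * (|r| + 1)))
    (Eventually.of_forall fun r => (h.integrable_exp_primitive r).aestronglyMeasurable) ?_
    (integrable_const _)
    (Eventually.of_forall fun s => (h.continuous_primitive s).rexp.continuousAt)
  filter_upwards [(continuous_abs.tendsto r).eventually (gt_mem_nhds (lt_add_one |r|))] with y hy
  refine Eventually.of_forall fun s => ?_
  rw [Real.norm_eq_abs, Real.abs_exp]
  have := nonempty_of_isProbabilityMeasure P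
  have hK := h.bound_nonneg
  gcongr
  refine (le_abs_self _).trans ((h.abs_primitive_le y s).trans ?_)
  gcongr

theorem measurable_incrementCov_integrand (h : IsBoundedProcess W K) (τ : ℝ) :
    Measurable (Function.uncurry fun (r : ℝ) (s : S) =>
      Real.exp (primitive W r s) * (W r s * ∫ a in r..τ, W a s)) := by
  simp only [h.integral_eq_primitive_sub]
  exact h.measurable_primitive.exp.mul (h.measurable.mul
    (((h.measurable_primitive_apply τ).comp measurable_snd).sub h.measurable_primitive))

theorem incrementCov_integrand_bound (h : IsBoundedProcess W K) {τ r : ℝ} (hr : r ∈ Ioc 0 τ)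
    (s : S) : |Real.exp (primitive W r s) * (W r s * ∫ a in r..τ, W a s)| ≤
      Real.exp (K * τ) * (K * (K * τ)) := by
  have hK : 0 ≤ K := (abs_nonneg _).trans (h.abs_le 0 s)
  have hinc : |W r s * ∫ a in r..τ, W a s| ≤ K * (K * τ) := by
    rw [abs_mul]
    refine mul_le_mul (h.abs_le r s) ((h.abs_integral_le r τ s).trans ?_) (abs_nonneg _) hK
    rw [abs_of_nonneg (sub_nonneg.2 hr.2)]
    gcongr
    linarith [hr.1]
  refine (h.exp_primitive_mul_bound r hinc s).trans ?_
  rw [abs_of_pos hr.1]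
  have hτ : 0 ≤ τ := hr.1.le.trans hr.2
  gcongr
  exact hr.2

theorem intervalIntegrable_incrementCov (h : IsBoundedProcess W K) {τ : ℝ} (hτ : 0 ≤ τ) :
    IntervalIntegrable (incrementCov P W τ) volume 0 τ := by
  rw [intervalIntegrable_iff, uIoc_of_le hτ]
  refine Measure.integrableOn_of_bounded (M := Real.exp (K * τ) * (K * (K * τ))) (by simp)
    ((h.measurable_incrementCov_integrand τ).stronglyMeasurable.integral_prod_right
      (ν := P)).aestronglyMeasurable ?_
  filter_upwards [ae_restrict_mem measurableSet_Ioc] with r hr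
    using abs_integral_le_of_abs_le_const (h.incrementCov_integrand_bound hr)

theorem integral_primitive_eq_zero (h : IsBoundedProcess W K)
    (hcentered : ∀ r, 0 ≤ r → ∫ s, W r s ∂P = 0) {τ : ℝ} (hτ : 0 ≤ τ) :
    ∫ s, primitive W τ s ∂P = 0 := by
  unfold primitive
  rw [integral_intervalIntegral_swap h.measurable hτ fun r _ => h.abs_le r]
  refine intervalIntegral.integral_zero_ae (Eventually.of_forall fun r hr => hcentered r ?_)
  rw [uIoc_of_le hτ] at hr
  exact hr.1.le

theorem expMoment_eq (h : IsBoundedProcess W K) (hcentered : ∀ r, 0 ≤ r → ∫ s, W r s ∂P = 0)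
    {τ : ℝ} (hτ : 0 ≤ τ) :
    expMoment P W τ = 1 + ∫ r in (0 : ℝ)..τ, incrementCov P W τ r := by
  have hpath (s : S) : Real.exp (primitive W τ s) - (1 + primitive W τ s) =
      ∫ r in (0 : ℝ)..τ, Real.exp (primitive W r s) * (W r s * ∫ a in r..τ, W a s) :=
    sub_eq_of_eq_add' (exp_primitive_eq_second_order (h.intervalIntegrable s 0 τ))
  have hswap := integral_intervalIntegral_swap (P := P) (h.measurable_incrementCov_integrand τ) hτ
    (fun r hr => h.incrementCov_integrand_bound hr)
  have hZ := h.integrable_primitive (P := P) τ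
  simp only [← hpath] at hswap
  rw [integral_sub (g := fun s => 1 + primitive W τ s) (h.integrable_exp_primitive τ)
    ((integrable_const 1).add hZ), integral_add (integrable_const 1) hZ,
    h.integral_primitive_eq_zero hcentered hτ] at hswap
  simp only [integral_const, probReal_univ, smul_eq_mul, mul_one, add_zero] at hswap
  exact eq_add_of_sub_eq' hswap

theorem measurable_tiltedLagCov_integrand (h : IsBoundedProcess W K) (g r : ℝ) :
    Measurable (Function.uncurry fun (u : ℝ) (s : S) =>
      Real.exp (primitive W g s) * (W r s * W (r + u) s)) :=
  ((h.measurable_primitive_apply g).comp measurable_snd).exp.mul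
    (((h.measurable_apply r).comp measurable_snd).mul (h.measurable.comp
      (by fun_prop : Measurable fun p : ℝ × S => (r + p.1, p.2))))

theorem stronglyMeasurable_tiltedLagCov (h : IsBoundedProcess W K) (g r : ℝ) :
    StronglyMeasurable (tiltedLagCov P W g r) :=
  (h.measurable_tiltedLagCov_integrand g r).stronglyMeasurable.integral_prod_right

theorem incrementCov_eq (h : IsBoundedProcess W K) {τ r : ℝ} (hr : r ≤ τ) :
    incrementCov P W τ r = ∫ u in (0 : ℝ)..τ - r, tiltedLagCov P W r r u := by
  unfold tiltedLagCov incrementCov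
  rw [← integral_intervalIntegral_swap (P := P) (h.measurable_tiltedLagCov_integrand r r)
    (sub_nonneg.2 hr) fun u _ s => h.exp_primitive_mul_bound r (h.abs_mul_le r (r + u) s) s]
  refine integral_congr_ae (Eventually.of_forall fun s => ?_)
  simp only [intervalIntegral.integral_const_mul]
  rw [intervalIntegral.integral_comp_add_left (fun a => W a s), add_zero, add_sub_cancel]

theorem abs_integral_exp_mul_sub_le (h : IsBoundedProcess W K) {g r L : ℝ} (hL : |r - g| ≤ L)
    {f : S → ℝ} (hf : Measurable f) {C : ℝ} (hC : ∀ s, |f s| ≤ C) :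
    |∫ s, Real.exp (primitive W r s) * f s ∂P - ∫ s, Real.exp (primitive W g s) * f s ∂P| ≤
      expMoment P W g * (C * (Real.exp (K * L) - 1)) := by
  rw [← integral_sub (h.integrable_exp_primitive_mul r hf hC)
    (h.integrable_exp_primitive_mul g hf hC), expMoment, ← integral_mul_const]
  refine abs_integral_le_of_abs_le ((h.integrable_exp_primitive g).mul_const _)
    (Eventually.of_forall fun s => ?_)
  have := nonempty_of_isProbabilityMeasure P
  have hK := h.bound_nonneg
  have hfactor : Real.exp (primitive W r s) * f s - Real.exp (primitive W g s) * f s =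
      Real.exp (primitive W g s) * (f s * (Real.exp (∫ a in g..r, W a s) - 1)) := by
    rw [h.integral_eq_primitive_sub, Real.exp_sub]
    field_simp
  have hexp : |Real.exp (∫ a in g..r, W a s) - 1| ≤ Real.exp (K * L) - 1 := by
    refine (abs_exp_sub_one_le _).trans (sub_le_sub_right (Real.exp_le_exp.2 ?_) 1)
    exact (h.abs_integral_le g r s).trans (mul_le_mul_of_nonneg_left hL hK)
  rw [hfactor, abs_mul, abs_mul, Real.abs_exp]
  exact mul_le_mul_of_nonneg_left (mul_le_mul (hC s) hexp (abs_nonneg _)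
    ((abs_nonneg _).trans (hC s))) (Real.exp_pos _).le

end IsBoundedProcess

/-- A bounded centred process whose dependence between the past and a future at the distance `u` is
controlled by `θ u`. -/
structure WeaklyDependent (P : Measure S) (W : ℝ → S → ℝ) (K : ℝ) (θ : ℝ → ℝ) : Prop
    extends IsBoundedProcess W K where
  integrableOn : IntegrableOn θ (Ioi 0)
  centered : ∀ r, 0 ≤ r → ∫ s, W r s ∂P = 0
  abs_tiltedLagCov_le : ∀ g r u, 0 ≤ g → g ≤ r → 0 ≤ u →
    |tiltedLagCov P W g r u| ≤ θ u * expMoment P W g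
  abs_tiltedLagCov_sub_le : ∀ g r u, 0 ≤ g → g ≤ r → 0 ≤ u →
    |tiltedLagCov P W g r u - expMoment P W g * lagCov P W r u| ≤ θ (r - g) * expMoment P W g

/-- A bound for the relative cost of replacing `exp(∫₀ʳ W)` by `exp(∫₀ʳ⁻ᴸ W)` in the covariances at
the time `r` and of then decorrelating across the gap of length `L`. -/
noncomputable def gapError (K L : ℝ) (θ : ℝ → ℝ) : ℝ :=
  2 * (K * K * (Real.exp (K * L) - 1)) + θ L

/-- The error in the comparison of the exponential moment at the time `t` with the exponential of
half the variance, for the gap length `L`. -/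
noncomputable def comparisonError (K L t : ℝ) (θ : ℝ → ℝ) : ℝ :=
  t * (∫ u in Ioi (0 : ℝ), min (2 * θ u) (gapError K L θ)) +
    ∫ r in (0 : ℝ)..t, ∫ u in Ioi r, θ u

namespace WeaklyDependent

variable [IsProbabilityMeasure P] {θ : ℝ → ℝ}

theorem abs_lagCov_le (h : WeaklyDependent P W K θ) {r u : ℝ} (hr : 0 ≤ r) (hu : 0 ≤ u) :
    |lagCov P W r u| ≤ θ u := by
  simpa using h.abs_tiltedLagCov_le 0 r u le_rfl hr hu

theorem theta_nonneg (h : WeaklyDependent P W K θ) {u : ℝ} (hu : 0 ≤ u) : 0 ≤ θ u :=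
  (abs_nonneg _).trans (h.abs_lagCov_le le_rfl hu)

theorem integral_theta_nonneg (h : WeaklyDependent P W K θ) : 0 ≤ ∫ u in Ioi (0 : ℝ), θ u :=
  setIntegral_nonneg measurableSet_Ioi fun _ hu => h.theta_nonneg (le_of_lt hu)

theorem integrableOn_lagCov (h : WeaklyDependent P W K θ) {r : ℝ} (hr : 0 ≤ r) :
    IntegrableOn (lagCov P W r) (Ioi 0) := by
  refine Integrable.mono' h.integrableOn ((stronglyMeasurable_lagCov h.measurable).comp_measurable
    measurable_prodMk_left).aestronglyMeasurable ?_
  filter_upwards [ae_restrict_mem measurableSet_Ioi] with u hu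
    using h.abs_lagCov_le hr (le_of_lt hu)

theorem abs_lagRate_le (h : WeaklyDependent P W K θ) {r : ℝ} (hr : 0 ≤ r) :
    |lagRate P W r| ≤ ∫ u in Ioi (0 : ℝ), θ u := by
  refine abs_integral_le_of_abs_le h.integrableOn ?_
  filter_upwards [ae_restrict_mem measurableSet_Ioi] with u hu
    using h.abs_lagCov_le hr (le_of_lt hu)

theorem intervalIntegrable_lagRate (h : WeaklyDependent P W K θ) {t : ℝ} (ht : 0 ≤ t) :
    IntervalIntegrable (lagRate P W) volume 0 t := by
  rw [intervalIntegrable_iff, uIoc_of_le ht]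
  refine Measure.integrableOn_of_bounded (M := ∫ u in Ioi (0 : ℝ), θ u) (by simp)
    ((stronglyMeasurable_lagCov h.measurable).integral_prod_right
      (ν := volume.restrict (Ioi 0))).aestronglyMeasurable ?_
  filter_upwards [ae_restrict_mem measurableSet_Ioc] with r hr using h.abs_lagRate_le hr.1.le

theorem abs_incrementCov_le (h : WeaklyDependent P W K θ) {τ r : ℝ} (hr : 0 ≤ r) (hrτ : r ≤ τ) :
    |incrementCov P W τ r| ≤ (∫ u in Ioi (0 : ℝ), θ u) * expMoment P W r := by
  rw [h.incrementCov_eq hrτ, ← integral_mul_const]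
  exact abs_intervalIntegral_le_setIntegral_Ioi (sub_nonneg.2 hrτ) (h.integrableOn.mul_const _)
    (fun u hu => mul_nonneg (h.theta_nonneg (le_of_lt hu)) (h.expMoment_pos r).le)
    fun u hu => h.abs_tiltedLagCov_le r r u hr le_rfl hu.1.le

theorem expMoment_le (h : WeaklyDependent P W K θ) {τ t : ℝ} (hτ : 0 ≤ τ) (hτt : τ ≤ t) :
    expMoment P W τ ≤ Real.exp ((∫ u in Ioi (0 : ℝ), θ u) * t) := by
  have hcont : Continuous (expMoment P W) := h.continuous_expMoment
  have hgronwall := le_mul_exp_of_le_add_integral (a := 0) (b := t) (A := 1) hcont.continuousOn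
    h.integral_theta_nonneg (fun x hx => ?_) ⟨hτ, hτt⟩
  · rw [one_mul, sub_zero] at hgronwall
    refine hgronwall.trans (Real.exp_le_exp.2 ?_)
    exact mul_le_mul_of_nonneg_left hτt h.integral_theta_nonneg
  rw [h.expMoment_eq h.centered hx.1, ← intervalIntegral.integral_const_mul]
  gcongr
  exact (le_abs_self _).trans (abs_intervalIntegral_le_of_abs_le hx.1
    ((hcont.intervalIntegrable _ _).const_mul _)
    fun r hr => h.abs_incrementCov_le hr.1.le hr.2)

theorem gapError_nonneg (h : WeaklyDependent P W K θ) {L : ℝ} (hL : 0 ≤ L) :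
    0 ≤ gapError K L θ := by
  have := nonempty_of_isProbabilityMeasure P
  have hK := h.bound_nonneg
  have hexp : 1 ≤ Real.exp (K * L) := Real.one_le_exp (by positivity)
  have hθ := h.theta_nonneg hL
  unfold gapError
  positivity

theorem min_gapError_nonneg (h : WeaklyDependent P W K θ) {L : ℝ} (hL : 0 ≤ L) {u : ℝ}
    (hu : 0 ≤ u) : 0 ≤ min (2 * θ u) (gapError K L θ) :=
  le_min (mul_nonneg zero_le_two (h.theta_nonneg hu)) (h.gapError_nonneg hL)

theorem integrableOn_min_gapError (h : WeaklyDependent P W K θ) {L : ℝ} (hL : 0 ≤ L) :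
    IntegrableOn (fun u => min (2 * θ u) (gapError K L θ)) (Ioi 0) := by
  refine Integrable.mono' (h.integrableOn.const_mul 2)
    ((h.integrableOn.const_mul 2).aestronglyMeasurable.inf aestronglyMeasurable_const) ?_
  filter_upwards [ae_restrict_mem measurableSet_Ioi] with u hu
  rw [Real.norm_eq_abs, abs_of_nonneg (h.min_gapError_nonneg hL (le_of_lt hu))]
  exact min_le_left _ _

theorem abs_tiltedLagCov_self_sub_le (h : WeaklyDependent P W K θ) {r u : ℝ} (hr : 0 ≤ r)
    (hu : 0 ≤ u) : |tiltedLagCov P W r r u - expMoment P W r * lagCov P W r u| ≤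
      expMoment P W r * (2 * θ u) := by
  have hM := (h.expMoment_pos (P := P) r).le
  have hprod : |expMoment P W r * lagCov P W r u| ≤ expMoment P W r * θ u := by
    rw [abs_mul, abs_of_nonneg hM]
    exact mul_le_mul_of_nonneg_left (h.abs_lagCov_le hr hu) hM
  refine (abs_sub _ _).trans ?_
  linarith [h.abs_tiltedLagCov_le r r u hr le_rfl hu]

/-- Tilt by the density stopped at `g = max (r - L) 0`; if `g = 0` that density is `1`, and no
decorrelation is needed. -/
theorem exists_abs_tiltedLagCov_sub_le_gapError (h : WeaklyDependent P W K θ) {L : ℝ} (hL : 0 ≤ L)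
    {r u : ℝ} (hr : 0 ≤ r) (hu : 0 ≤ u) : ∃ g ∈ Icc 0 r,
      |tiltedLagCov P W r r u - expMoment P W r * lagCov P W r u| ≤
        expMoment P W g * gapError K L θ := by
  set g : ℝ := max (r - L) 0
  have hg : g ∈ Icc 0 r := ⟨le_max_right _ _, max_le (by linarith) hr⟩
  have hgap : |r - g| ≤ L := by
    rw [abs_of_nonneg (sub_nonneg.2 hg.2)]
    linarith [le_max_left (r - L) 0]
  have htilt : |tiltedLagCov P W r r u - tiltedLagCov P W g r u| ≤ _ :=
    h.abs_integral_exp_mul_sub_le hgap ((h.measurable_apply r).mul (h.measurable_apply (r + u)))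
      (h.abs_mul_le r (r + u))
  have hmoment : |expMoment P W r - expMoment P W g| ≤
      expMoment P W g * (Real.exp (K * L) - 1) := by
    simpa [expMoment] using h.abs_integral_exp_mul_sub_le (P := P) hgap
      (f := fun _ => 1) measurable_const (C := 1) (by simp)
  have hdecorrelate : |tiltedLagCov P W g r u - expMoment P W g * lagCov P W r u| ≤
      θ L * expMoment P W g := by
    rcases le_total L r with hLr | hLr
    · have hgL : g = r - L := max_eq_left (sub_nonneg.2 hLr)
      simpa [hgL] using h.abs_tiltedLagCov_sub_le g r u hg.1 hg.2 hu
    · have hg0 : g = 0 := max_eq_right (sub_nonpos.2 hLr)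
      simpa [hg0] using h.theta_nonneg hL
  have hprod : |(expMoment P W g - expMoment P W r) * lagCov P W r u| ≤
      expMoment P W g * (Real.exp (K * L) - 1) * (K * K) := by
    rw [abs_mul, abs_sub_comm]
    exact mul_le_mul hmoment (abs_integral_le_of_abs_le_const (h.abs_mul_le r (r + u)))
      (abs_nonneg _) ((abs_nonneg _).trans hmoment)
  refine ⟨g, hg, ?_⟩
  calc |tiltedLagCov P W r r u - expMoment P W r * lagCov P W r u|
      = |(tiltedLagCov P W r r u - tiltedLagCov P W g r u) +
          (tiltedLagCov P W g r u - expMoment P W g * lagCov P W r u) +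
          (expMoment P W g - expMoment P W r) * lagCov P W r u| := by congr 1; ring
    _ ≤ expMoment P W g * (K * K * (Real.exp (K * L) - 1)) + θ L * expMoment P W g +
          expMoment P W g * (Real.exp (K * L) - 1) * (K * K) :=
        (abs_add_three _ _ _).trans (add_le_add_three htilt hdecorrelate hprod)
    _ = expMoment P W g * gapError K L θ := by unfold gapError; ring

theorem abs_tiltedLagCov_self_sub_le_min (h : WeaklyDependent P W K θ) {L : ℝ} (hL : 0 ≤ L)
    {r t u : ℝ} (hr : 0 ≤ r) (hrt : r ≤ t) (hu : 0 ≤ u) :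
    |tiltedLagCov P W r r u - expMoment P W r * lagCov P W r u| ≤
      Real.exp ((∫ u in Ioi (0 : ℝ), θ u) * t) * min (2 * θ u) (gapError K L θ) := by
  rw [mul_min_of_nonneg _ _ (Real.exp_pos _).le]
  obtain ⟨g, hg, hgap⟩ := h.exists_abs_tiltedLagCov_sub_le_gapError hL hr hu
  refine le_min ((h.abs_tiltedLagCov_self_sub_le hr hu).trans ?_) (hgap.trans ?_)
  · exact mul_le_mul_of_nonneg_right (h.expMoment_le hr hrt)
      (mul_nonneg zero_le_two (h.theta_nonneg hu))
  · exact mul_le_mul_of_nonneg_right (h.expMoment_le hg.1 (hg.2.trans hrt)) (h.gapError_nonneg hL)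

theorem abs_integral_tiltedLagCov_sub_le (h : WeaklyDependent P W K θ) {L : ℝ} (hL : 0 ≤ L)
    {r t x : ℝ} (hr : 0 ≤ r) (hrt : r ≤ t) (hx : 0 ≤ x) :
    |∫ u in (0 : ℝ)..x, (tiltedLagCov P W r r u - expMoment P W r * lagCov P W r u)| ≤
      Real.exp ((∫ u in Ioi (0 : ℝ), θ u) * t) *
        ∫ u in Ioi (0 : ℝ), min (2 * θ u) (gapError K L θ) := by
  rw [← integral_const_mul]
  exact abs_intervalIntegral_le_setIntegral_Ioi hx ((h.integrableOn_min_gapError hL).const_mul _)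
    (fun u hu => mul_nonneg (Real.exp_pos _).le (h.min_gapError_nonneg hL (le_of_lt hu)))
    fun u hu => h.abs_tiltedLagCov_self_sub_le_min hL hr hrt hu.1.le

theorem abs_expMoment_mul_integral_Ioi_lagCov_le (h : WeaklyDependent P W K θ) {r t x : ℝ}
    (hr : 0 ≤ r) (hrt : r ≤ t) (hx : 0 ≤ x) :
    |expMoment P W r * ∫ u in Ioi x, lagCov P W r u| ≤
      Real.exp ((∫ u in Ioi (0 : ℝ), θ u) * t) * ∫ u in Ioi x, θ u := by
  rw [abs_mul, abs_of_nonneg (h.expMoment_pos r).le]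
  refine mul_le_mul (h.expMoment_le hr hrt) ?_ (abs_nonneg _) (Real.exp_pos _).le
  refine abs_integral_le_of_abs_le (h.integrableOn.mono_set (Ioi_subset_Ioi hx)) ?_
  filter_upwards [ae_restrict_mem measurableSet_Ioi] with u hu
    using h.abs_lagCov_le hr (hx.trans (le_of_lt hu))

theorem intervalIntegrable_tiltedLagCov (h : WeaklyDependent P W K θ) {r x : ℝ} (hr : 0 ≤ r)
    (hx : 0 ≤ x) : IntervalIntegrable (tiltedLagCov P W r r) volume 0 x := by
  rw [intervalIntegrable_iff_integrableOn_Ioc_of_le hx]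
  refine Integrable.mono' (IntegrableOn.mono_set (h.integrableOn.mul_const (expMoment P W r))
    Ioc_subset_Ioi_self) (h.stronglyMeasurable_tiltedLagCov r r).aestronglyMeasurable ?_
  filter_upwards [ae_restrict_mem measurableSet_Ioc] with u hu
    using h.abs_tiltedLagCov_le r r u hr le_rfl hu.1.le

theorem abs_incrementCov_sub_le (h : WeaklyDependent P W K θ) {L : ℝ} (hL : 0 ≤ L) {t τ r : ℝ}
    (hr : 0 ≤ r) (hrτ : r ≤ τ) (hτ : τ ≤ t) :
    |incrementCov P W τ r - expMoment P W r * lagRate P W r| ≤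
      Real.exp ((∫ u in Ioi (0 : ℝ), θ u) * t) *
        ((∫ u in Ioi (0 : ℝ), min (2 * θ u) (gapError K L θ)) + ∫ u in Ioi (τ - r), θ u) := by
  have hx : 0 ≤ τ - r := sub_nonneg.2 hrτ
  have hlag := h.integrableOn_lagCov hr
  have hlagx : IntervalIntegrable (lagCov P W r) volume 0 (τ - r) :=
    (intervalIntegrable_iff_integrableOn_Ioc_of_le hx).2 (hlag.mono_set Ioc_subset_Ioi_self)
  have hsplit : incrementCov P W τ r - expMoment P W r * lagRate P W r =
      (∫ u in (0 : ℝ)..τ - r, (tiltedLagCov P W r r u - expMoment P W r * lagCov P W r u)) -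
        expMoment P W r * ∫ u in Ioi (τ - r), lagCov P W r u := by
    rw [h.incrementCov_eq hrτ, lagRate, ← intervalIntegral.integral_interval_add_Ioi hlag
      (hlag.mono_set (Ioi_subset_Ioi hx)), intervalIntegral.integral_sub
      (h.intervalIntegrable_tiltedLagCov hr hx) (hlagx.const_mul _),
      intervalIntegral.integral_const_mul]
    ring
  rw [hsplit, mul_add]
  exact (abs_sub _ _).trans (add_le_add
    (h.abs_integral_tiltedLagCov_sub_le hL hr (hrτ.trans hτ) hx)
    (h.abs_expMoment_mul_integral_Ioi_lagCov_le hr (hrτ.trans hτ) hx))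

theorem intervalIntegrable_tail (h : WeaklyDependent P W K θ) {t : ℝ} (ht : 0 ≤ t) :
    IntervalIntegrable (fun r => ∫ u in Ioi r, θ u) volume 0 t := by
  refine AntitoneOn.intervalIntegrable ?_
  rw [uIcc_of_le ht]
  exact (antitoneOn_setIntegral_Ioi h.integrableOn
    fun u hu => h.theta_nonneg (le_of_lt hu)).mono Icc_subset_Ici_self

theorem abs_expMoment_sub_integral_le (h : WeaklyDependent P W K θ) {L : ℝ} (hL : 0 ≤ L)
    {t τ : ℝ} (hτ : τ ∈ Icc 0 t) :
    |expMoment P W τ - 1 - ∫ r in (0 : ℝ)..τ, expMoment P W r * lagRate P W r| ≤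
      Real.exp ((∫ u in Ioi (0 : ℝ), θ u) * t) * comparisonError K L t θ := by
  set E := Real.exp ((∫ u in Ioi (0 : ℝ), θ u) * t)
  set I := ∫ u in Ioi (0 : ℝ), min (2 * θ u) (gapError K L θ)
  have hI0 : 0 ≤ I := setIntegral_nonneg measurableSet_Ioi fun u hu =>
    h.min_gapError_nonneg hL (le_of_lt hu)
  have htail : IntervalIntegrable (fun r => ∫ u in Ioi (τ - r), θ u) volume 0 τ := by
    simpa using ((h.intervalIntegrable_tail hτ.1).comp_sub_left τ).symm
  have hmono : ∫ r in (0 : ℝ)..τ, ∫ u in Ioi r, θ u ≤ ∫ r in (0 : ℝ)..t, ∫ u in Ioi r, θ u := by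
    refine intervalIntegral.integral_mono_interval le_rfl hτ.1 hτ.2 ?_
      (h.intervalIntegrable_tail (hτ.1.trans hτ.2))
    filter_upwards [ae_restrict_mem measurableSet_Ioc] with r hr using
      setIntegral_nonneg measurableSet_Ioi fun u hu => h.theta_nonneg (hr.1.le.trans (le_of_lt hu))
  have hrate : IntervalIntegrable (fun r => expMoment P W r * lagRate P W r) volume 0 τ :=
    (h.intervalIntegrable_lagRate hτ.1).continuousOn_mul h.continuous_expMoment.continuousOn
  rw [h.expMoment_eq h.centered hτ.1, add_sub_cancel_left,
    ← intervalIntegral.integral_sub (h.intervalIntegrable_incrementCov hτ.1) hrate]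
  calc |∫ r in (0 : ℝ)..τ, (incrementCov P W τ r - expMoment P W r * lagRate P W r)|
      ≤ ∫ r in (0 : ℝ)..τ, E * (I + ∫ u in Ioi (τ - r), θ u) :=
        abs_intervalIntegral_le_of_abs_le hτ.1 ((intervalIntegrable_const.add htail).const_mul E)
          fun r hr => h.abs_incrementCov_sub_le hL hr.1.le hr.2 hτ.2
    _ = E * (τ * I + ∫ r in (0 : ℝ)..τ, ∫ u in Ioi r, θ u) := by
        rw [intervalIntegral.integral_const_mul,
          intervalIntegral.integral_add intervalIntegrable_const htail,
          intervalIntegral.integral_const,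
          intervalIntegral.integral_comp_sub_left (fun r => ∫ u in Ioi r, θ u), sub_self, sub_zero,
          smul_eq_mul]
    _ ≤ E * comparisonError K L t θ := by
        unfold comparisonError
        gcongr
        exact hτ.2

/-- Both `expMoment P W` and the exponential of the integrated rate solve `f' = lagRate · f`, the
former up to `comparisonError`; Grönwall's inequality compares them. -/
theorem abs_expMoment_sub_exp_le (h : WeaklyDependent P W K θ) {L : ℝ} (hL : 0 ≤ L) {t : ℝ}
    (ht : 0 ≤ t) :
    |expMoment P W t - Real.exp (∫ r in (0 : ℝ)..t, lagRate P W r)| ≤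
      Real.exp (2 * (∫ u in Ioi (0 : ℝ), θ u) * t) * comparisonError K L t θ := by
  set N : ℝ → ℝ := fun τ => Real.exp (∫ r in (0 : ℝ)..τ, lagRate P W r)
  have hM : Continuous (expMoment P W) := h.continuous_expMoment
  have hN : ContinuousOn N (Icc 0 t) := by
    have := intervalIntegral.continuousOn_primitive_interval'
      (h.intervalIntegrable_lagRate ht) left_mem_uIcc
    rw [uIcc_of_le ht] at this
    exact this.rexp
  have hintegral : ∀ τ ∈ Icc 0 t, |expMoment P W τ - N τ| ≤
      Real.exp ((∫ u in Ioi (0 : ℝ), θ u) * t) * comparisonError K L t θ +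
        (∫ u in Ioi (0 : ℝ), θ u) * ∫ r in (0 : ℝ)..τ, |expMoment P W r - N r| := by
    intro τ hτ
    have hrate := h.intervalIntegrable_lagRate hτ.1
    have hNτ : ContinuousOn N (uIcc 0 τ) := by
      rw [uIcc_of_le hτ.1]
      exact hN.mono (Icc_subset_Icc_right hτ.2)
    have hsplit : expMoment P W τ - N τ = (expMoment P W τ - 1 -
        ∫ r in (0 : ℝ)..τ, expMoment P W r * lagRate P W r) +
        ∫ r in (0 : ℝ)..τ, (expMoment P W r * lagRate P W r - N r * lagRate P W r) := by
      rw [intervalIntegral.integral_sub (hrate.continuousOn_mul hM.continuousOn)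
        (hrate.continuousOn_mul hNτ), show N τ = _ from exp_primitive_eq hrate]
      ring
    have hdiff : |∫ r in (0 : ℝ)..τ, (expMoment P W r * lagRate P W r - N r * lagRate P W r)| ≤
        (∫ u in Ioi (0 : ℝ), θ u) * ∫ r in (0 : ℝ)..τ, |expMoment P W r - N r| := by
      rw [← intervalIntegral.integral_const_mul]
      refine abs_intervalIntegral_le_of_abs_le hτ.1
        ((hM.continuousOn.sub hNτ).abs.intervalIntegrable.const_mul _) fun r hr => ?_
      rw [← sub_mul, abs_mul, mul_comm]
      exact mul_le_mul_of_nonneg_right (h.abs_lagRate_le hr.1.le) (abs_nonneg _)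
    rw [hsplit]
    exact (abs_add_le _ _).trans (add_le_add (h.abs_expMoment_sub_integral_le hL hτ) hdiff)
  refine (le_mul_exp_of_le_add_integral (hM.continuousOn.sub hN).abs h.integral_theta_nonneg
    hintegral ⟨ht, le_rfl⟩).trans (le_of_eq ?_)
  rw [mul_right_comm, ← Real.exp_add, sub_zero]
  ring_nf

end WeaklyDependent

end WeakDependence

section UniformMixing

variable {S : Type*} {m m₁ m₂ : MeasurableSpace S} [mS : MeasurableSpace S] {P : Measure S}

/-- Uniform (or `φ`-) mixing of two σ-algebras: conditioning on an event of `m₂` changes the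
probability of an event of `m₁` by at most `φ`. The inequality is multiplied by `P D`, so that it
also makes sense for null `D`. -/
def UniformlyMixing (P : Measure S) (m₁ m₂ : MeasurableSpace S) (φ : ℝ) : Prop :=
  ∀ A D, MeasurableSet[m₁] A → MeasurableSet[m₂] D →
    |P.real (A ∩ D) - P.real A * P.real D| ≤ φ * P.real D

theorem antitone_measureReal_le (μ : Measure S) [IsFiniteMeasure μ] (f : S → ℝ) :
    Antitone fun t : ℝ => μ.real {s | t ≤ f s} :=
  fun _ _ hab => measureReal_mono fun _ => hab.trans

theorem integral_add_eq_integral_Ioc_measureReal_le {μ : Measure S} [IsFiniteMeasure μ]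
    {h : S → ℝ} {H : ℝ} (hh : Integrable h μ) (hH : ∀ s, |h s| ≤ H) :
    ∫ s, h s ∂μ + H * μ.real univ = ∫ t in Ioc 0 (2 * H), μ.real {s | t ≤ h s + H} := by
  rw [← (hh.add (integrable_const H)).integral_eq_integral_Ioc_meas_le
      (f := fun s => h s + H) (M := 2 * H)
      (Eventually.of_forall fun s => by
        change 0 ≤ h s + H
        linarith [neg_le_of_abs_le (hH s)])
      (Eventually.of_forall fun s => by
        change h s + H ≤ 2 * H
        linarith [le_of_abs_le (hH s)]),
    integral_add hh (integrable_const _), integral_const, smul_eq_mul, mul_comm]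

variable [IsProbabilityMeasure P] {φ : ℝ}

theorem UniformlyMixing.abs_setIntegral_sub_le (hmix : UniformlyMixing P m₁ m₂ φ) (hm₁ : m₁ ≤ mS)
    (hm₂ : m₂ ≤ mS) {h : S → ℝ} {H : ℝ} (hh : Measurable[m₁] h) (hH : ∀ s, |h s| ≤ H) {D : Set S}
    (hD : MeasurableSet[m₂] D) :
    |∫ s in D, h s ∂P - (∫ s, h s ∂P) * P.real D| ≤ 2 * H * φ * P.real D := by
  have hint : Integrable h P := .of_bound (hh.mono hm₁ le_rfl).aestronglyMeasurable H
    (Eventually.of_forall hH)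
  have hH0 : 0 ≤ H := by
    obtain ⟨s⟩ := nonempty_of_isProbabilityMeasure P
    exact (abs_nonneg _).trans (hH s)
  have hlayer (μ : Measure S) [IsFiniteMeasure μ] :
      IntegrableOn (fun t => μ.real {s | t ≤ h s + H}) (Ioc 0 (2 * H)) :=
    ((antitone_measureReal_le μ _).antitoneOn (uIcc 0 (2 * H))).intervalIntegrable.1
  have hdiff : ∫ s in D, h s ∂P - (∫ s, h s ∂P) * P.real D =
      ∫ t in Ioc 0 (2 * H), ((P.restrict D).real {s | t ≤ h s + H} -
        P.real {s | t ≤ h s + H} * P.real D) := by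
    rw [integral_sub (hlayer _) ((hlayer P).mul_const _), integral_mul_const,
      ← integral_add_eq_integral_Ioc_measureReal_le hint hH,
      ← integral_add_eq_integral_Ioc_measureReal_le hint.restrict hH,
      measureReal_restrict_apply_univ, probReal_univ]
    ring
  have hlevel : ∀ t ∈ Ioc 0 (2 * H), ‖(P.restrict D).real {s | t ≤ h s + H} -
      P.real {s | t ≤ h s + H} * P.real D‖ ≤ φ * P.real D := by
    intro t _
    rw [measureReal_restrict_apply' (hm₂ D hD)]
    exact hmix _ _ (measurableSet_le measurable_const (hh.add_const H)) hD
  rw [hdiff]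
  refine (norm_setIntegral_le_of_norm_le_const measure_Ioc_lt_top hlevel).trans (le_of_eq ?_)
  rw [Real.volume_real_Ioc_of_le (by linarith)]
  ring

theorem ae_abs_le_of_abs_setIntegral_le (hm : m ≤ mS) {g : S → ℝ} (hg : StronglyMeasurable[m] g)
    (hgi : Integrable g P) {C : ℝ}
    (h : ∀ D, MeasurableSet[m] D → |∫ s in D, g s ∂P| ≤ C * P.real D) : ∀ᵐ s ∂P, |g s| ≤ C := by
  have hgt : Integrable g (P.trim hm) := hgi.trim hm hg
  have hset : ∀ D, MeasurableSet[m] D → |∫ s in D, g s ∂P.trim hm| ≤ ∫ _ in D, C ∂P.trim hm := by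
    intro D hD
    rw [← setIntegral_trim hm hg hD, setIntegral_const, smul_eq_mul, mul_comm, Measure.real,
      trim_measurableSet_eq hm hD]
    exact h D hD
  have hle : g ≤ᵐ[P.trim hm] fun _ => C :=
    ae_le_of_forall_setIntegral_le hgt (integrable_const _) fun D hD _ =>
      (le_abs_self _).trans (hset D hD)
  have hge : (fun s => -g s) ≤ᵐ[P.trim hm] fun _ => C := by
    refine ae_le_of_forall_setIntegral_le hgt.neg (integrable_const _) fun D hD _ => ?_
    rw [integral_neg]
    exact (neg_le_abs _).trans (hset D hD)
  filter_upwards [ae_of_ae_trim hm hle, ae_of_ae_trim hm hge] with s hs hs'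
    using abs_le'.2 ⟨hs, hs'⟩

/-- Ibragimov's covariance inequality: by `UniformlyMixing.abs_setIntegral_sub_le` the conditional
expectation of `h - E h` given `m₂` is at most `2 * H * φ`. -/
theorem UniformlyMixing.abs_integral_mul_sub_le (hmix : UniformlyMixing P m₁ m₂ φ) (hm₁ : m₁ ≤ mS)
    (hm₂ : m₂ ≤ mS) {f h : S → ℝ} {H : ℝ} (hf : AEStronglyMeasurable[m₂] f P)
    (hfi : Integrable f P) (hh : Measurable[m₁] h) (hH : ∀ s, |h s| ≤ H) :
    |∫ s, f s * h s ∂P - (∫ s, f s ∂P) * ∫ s, h s ∂P| ≤ 2 * H * φ * ∫ s, |f s| ∂P := by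
  have hhm : AEStronglyMeasurable h P := (hh.mono hm₁ le_rfl).aestronglyMeasurable
  have hint : Integrable h P := .of_bound hhm H (Eventually.of_forall hH)
  set e := ∫ s, h s ∂P
  have hcentred : Integrable (fun s => h s - e) P := hint.sub (integrable_const _)
  have hfh : Integrable (fun s => f s * h s) P := hfi.mul_bdd hhm (Eventually.of_forall hH)
  have hfcentred : Integrable (fun s => f s * (h s - e)) P :=
    (hfh.sub (hfi.mul_const e)).congr (Eventually.of_forall fun s => (mul_sub _ _ _).symm)
  have hcond : ∀ᵐ s ∂P, |(P[fun s => h s - e | m₂]) s| ≤ 2 * H * φ := by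
    refine ae_abs_le_of_abs_setIntegral_le hm₂ stronglyMeasurable_condExp integrable_condExp
      fun D hD => ?_
    rw [setIntegral_condExp hm₂ hcentred hD, integral_sub hint.restrict (integrable_const _),
      setIntegral_const, smul_eq_mul, mul_comm (P.real D)]
    exact hmix.abs_setIntegral_sub_le hm₁ hm₂ hh hH hD
  have hcov : ∫ s, f s * h s ∂P - (∫ s, f s ∂P) * e =
      ∫ s, f s * (P[fun s => h s - e | m₂]) s ∂P := by
    rw [← integral_mul_const, ← integral_sub hfh (hfi.mul_const e)]
    simp only [← mul_sub]
    rw [← integral_condExp hm₂]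
    exact integral_congr_ae (condExp_mul_of_aestronglyMeasurable_left hf hfcentred hcentred)
  rw [hcov, ← integral_const_mul]
  refine abs_integral_le_of_abs_le (hfi.abs.const_mul _) ?_
  filter_upwards [hcond] with s hs
  rw [abs_mul, mul_comm]
  exact mul_le_mul_of_nonneg_right hs (abs_nonneg _)

end UniformMixing

section PathIntegral

variable {S : Type*} {m : MeasurableSpace S} [mS : MeasurableSpace S] {P : Measure S}
  [IsProbabilityMeasure P]

theorem integral_mul_sub_condExp_eq_zero (hm : m ≤ mS) {g Z : S → ℝ} {C : ℝ}
    (hg : AEStronglyMeasurable[m] g P) (hC : ∀ᵐ s ∂P, |g s| ≤ C) (hZ : Integrable Z P) :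
    ∫ s, g s * (Z s - (P[Z | m]) s) ∂P = 0 := by
  have hgZ : Integrable (fun s => g s * Z s) P := hZ.bdd_mul (hg.mono hm) hC
  have hgY : Integrable (fun s => g s * (P[Z | m]) s) P :=
    integrable_condExp.bdd_mul (hg.mono hm) hC
  simp only [mul_sub]
  rw [integral_sub hgZ hgY, sub_eq_zero, ← integral_condExp hm]
  exact integral_congr_ae (condExp_mul_of_aestronglyMeasurable_left hg hgZ hZ)

theorem aestronglyMeasurable_of_integral_mul_sub_condExp_eq_zero (hm : m ≤ mS) {Z : S → ℝ} {C : ℝ}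
    (hZ : AEStronglyMeasurable Z P) (hC : ∀ᵐ s ∂P, |Z s| ≤ C)
    (h : ∫ s, Z s * (Z s - (P[Z | m]) s) ∂P = 0) : AEStronglyMeasurable[m] Z P := by
  have hZi : Integrable Z P := .of_bound hZ C hC
  have hY : StronglyMeasurable[m] (P[Z | m]) := stronglyMeasurable_condExp
  have hYC : ∀ᵐ s ∂P, |(P[Z | m]) s| ≤ C := ae_bdd_abs_condExp_of_ae_bdd_abs hC
  have hd : Integrable (fun s => Z s - (P[Z | m]) s) P := hZi.sub integrable_condExp
  have hZd := hd.bdd_mul hZ hC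
  have hYd := hd.bdd_mul (hY.mono hm).aestronglyMeasurable hYC
  have hsq_eq : (fun s => (Z s - (P[Z | m]) s) ^ 2) =
      fun s => Z s * (Z s - (P[Z | m]) s) - (P[Z | m]) s * (Z s - (P[Z | m]) s) :=
    funext fun s => by ring
  have hsq : ∫ s, (Z s - (P[Z | m]) s) ^ 2 ∂P = 0 := by
    rw [hsq_eq, integral_sub hZd hYd, h,
      integral_mul_sub_condExp_eq_zero hm hY.aestronglyMeasurable hYC hZi, sub_zero]
  rw [integral_eq_zero_iff_of_nonneg (fun s => sq_nonneg _) (hsq_eq ▸ hZd.sub hYd)] at hsq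
  refine ⟨P[Z | m], hY, ?_⟩
  filter_upwards [hsq] with s hs using sub_eq_zero.1 (pow_eq_zero_iff two_ne_zero |>.1 hs)

/-- `W` is jointly measurable for the ambient σ-algebra only, so the integral need not be measurable
for `m`: what is true is that it almost surely equals its conditional expectation given `m`. -/
theorem IsBoundedProcess.aestronglyMeasurable_integral {W : ℝ → S → ℝ} {K : ℝ}
    (h : IsBoundedProcess W K) (hm : m ≤ mS) {a b : ℝ} (hab : a ≤ b)
    (hmeas : ∀ r ∈ Ioc a b, Measurable[m] (W r)) :
    AEStronglyMeasurable[m] (fun s => ∫ r in a..b, W r s) P := by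
  set Z : S → ℝ := fun s => ∫ r in a..b, W r s with hZ
  have hZm : AEStronglyMeasurable Z P := by
    simp only [hZ, h.integral_eq_primitive_sub]
    exact ((h.measurable_primitive_apply b).sub
      (h.measurable_primitive_apply a)).aestronglyMeasurable
  have hZK : ∀ᵐ s ∂P, |Z s| ≤ K * |b - a| := Eventually.of_forall (h.abs_integral_le a b)
  have hZi : Integrable Z P := .of_bound hZm _ hZK
  refine aestronglyMeasurable_of_integral_mul_sub_condExp_eq_zero hm hZm hZK ?_
  have hd : Integrable (fun p : S × ℝ => Z p.1 - (P[Z | m]) p.1)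
      (P.prod (volume.restrict (Ioc a b))) := (hZi.sub integrable_condExp).comp_fst _
  calc ∫ s, Z s * (Z s - (P[Z | m]) s) ∂P
      = ∫ s, (∫ r in Ioc a b, W r s * (Z s - (P[Z | m]) s)) ∂P := by
        simp only [integral_mul_const, hZ, intervalIntegral.integral_of_le hab]
    _ = ∫ r in Ioc a b, (∫ s, W r s * (Z s - (P[Z | m]) s) ∂P) :=
        integral_integral_swap (hd.bdd_mul (h.measurable.comp measurable_swap).aestronglyMeasurable
          (Eventually.of_forall fun p => h.abs_le p.2 p.1))
    _ = ∫ _ in Ioc a b, (0 : ℝ) := setIntegral_congr_fun measurableSet_Ioc fun r hr =>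
        integral_mul_sub_condExp_eq_zero hm (hmeas r hr).stronglyMeasurable.aestronglyMeasurable
          (Eventually.of_forall (h.abs_le r)) hZi
    _ = 0 := integral_zero _ _

end PathIntegral

section FieldAlong

variable {S : Type*} {c : ℝ≥0 → ℝ → S → ℝ}

/-- The field, multiplied by `η`, seen along the path `X`. -/
noncomputable def fieldAlong (c : ℝ≥0 → ℝ → S → ℝ) (η : ℝ) (X : ℝ → ℝ) (r : ℝ) (s : S) : ℝ :=
  η * c r.toNNReal (X r) s

/-- The range of the space-time path `a ↦ (a, X a)`, `a ∈ I`. -/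
def pathRange (X : ℝ → ℝ) (I : Set ℝ) : Set (ℝ≥0 × ℝ) :=
  (fun a => (a.toNNReal, X a)) '' I

theorem farApart_pathRange {X : ℝ → ℝ} {I J : Set ℝ} {d : ℝ} (hI : ∀ a ∈ I, 0 ≤ a)
    (hJ : ∀ b ∈ J, 0 ≤ b) (h : ∀ a ∈ I, ∀ b ∈ J, b + d ≤ a) :
    FarApart (pathRange X I) (pathRange X J) d := by
  rintro _ ⟨a, ha, rfl⟩ _ ⟨b, hb, rfl⟩
  simp only [Real.coe_toNNReal _ (hI a ha), Real.coe_toNNReal _ (hJ b hb)]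
  have hd : d ≤ a - b := by linarith [h a ha b hb]
  refine hd.trans ((le_abs_self _).trans ?_)
  rw [← Real.sqrt_sq_eq_abs]
  exact Real.sqrt_le_sqrt (le_add_of_nonneg_right (sq_nonneg _))

theorem measurable_sigmaField {A : Set (ℝ≥0 × ℝ)} {p : ℝ≥0 × ℝ} (hp : p ∈ A) :
    Measurable[sigmaField c A] (c p.1 p.2) :=
  measurable_iff_comap_le.2 (le_iSup₂ (f := fun (p : ℝ≥0 × ℝ) (_ : p ∈ A) =>
    MeasurableSpace.comap (c p.1 p.2) inferInstance) p hp)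

theorem measurable_fieldAlong_sigmaField {η : ℝ} {X : ℝ → ℝ} {I : Set ℝ} {a : ℝ} (ha : a ∈ I) :
    Measurable[sigmaField c (pathRange X I)] (fieldAlong c η X a) :=
  (measurable_const_mul η).comp (measurable_sigmaField (mem_image_of_mem _ ha))

variable [mS : MeasurableSpace S] {K : ℝ}

/-- A jointly measurable random field bounded by `K`. -/
structure IsBoundedField (c : ℝ≥0 → ℝ → S → ℝ) (K : ℝ) : Prop where
  measurable : Measurable fun p : (ℝ≥0 × ℝ) × S => c p.1.1 p.1.2 p.2
  abs_le : ∀ t x s, |c t x s| ≤ K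

theorem IsBoundedField.measurable_apply (hc : IsBoundedField c K) (t : ℝ≥0) (x : ℝ) :
    Measurable (c t x) :=
  hc.measurable.comp (measurable_prodMk_left (x := (t, x)))

theorem IsBoundedField.bound_nonneg [Nonempty S] (hc : IsBoundedField c K) : 0 ≤ K :=
  (abs_nonneg _).trans (hc.abs_le 0 0 (Classical.arbitrary S))

theorem IsBoundedField.sigmaField_le (hc : IsBoundedField c K) (A : Set (ℝ≥0 × ℝ)) :
    sigmaField c A ≤ mS :=
  iSup₂_le fun p _ => (hc.measurable_apply p.1 p.2).comap_le

variable {P : Measure S} [IsProbabilityMeasure P]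

theorem alphaUm_nonneg (r : ℝ) : 0 ≤ alphaUm P c r :=
  le_csSup (bddAbove_mixingDefects P c r) (zero_mem_mixingDefects P c r)

theorem FarApart.uniformlyMixing {A₁ A₂ : Set (ℝ≥0 × ℝ)} {r : ℝ} (hA : FarApart A₁ A₂ r)
    (hc : IsBoundedField c K) :
    UniformlyMixing P (sigmaField c A₁) (sigmaField c A₂) (alphaUm P c r) := by
  intro A D hA' hD
  rcases eq_or_ne (P D) 0 with hD0 | hD0
  · have hAD0 : P (A ∩ D) = 0 := measure_mono_null inter_subset_right hD0
    simp [Measure.real, hD0, hAD0]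
  · have hpos : 0 < P.real D := ENNReal.toReal_pos hD0 (measure_ne_top _ _)
    have hcond : (cond P D).real A = (P.real D)⁻¹ * P.real (A ∩ D) := by
      rw [inter_comm, Measure.real, cond_apply (hc.sigmaField_le A₂ D hD), ENNReal.toReal_mul,
        ENNReal.toReal_inv]
      rfl
    have hdefect : P.real (A ∩ D) - P.real A * P.real D =
        ((cond P D).real A - P.real A) * P.real D := by
      rw [hcond]
      field_simp
    rw [hdefect, abs_mul, abs_of_pos hpos]
    exact mul_le_mul_of_nonneg_right (le_csSup (bddAbove_mixingDefects P c r)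
      ⟨A₁, A₂, hA, A, D, hA', hD, hD0, rfl⟩) hpos.le

theorem isBoundedProcess_fieldAlong (hc : IsBoundedField c K) {η : ℝ} (hη : 0 ≤ η) {X : ℝ → ℝ}
    (hX : Measurable X) : IsBoundedProcess (fieldAlong c η X) (η * K) where
  measurable := (hc.measurable.comp (by fun_prop :
    Measurable fun q : ℝ × S => ((q.1.toNNReal, X q.1), q.2))).const_mul η
  abs_le r s := by
    rw [fieldAlong, abs_mul, abs_of_nonneg hη]
    exact mul_le_mul_of_nonneg_left (hc.abs_le _ _ s) hη

variable {η : ℝ} {X : ℝ → ℝ}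

theorem aestronglyMeasurable_exp_primitive_fieldAlong (hc : IsBoundedField c K) (hη : 0 ≤ η)
    (hX : Measurable X) {g r : ℝ} (hg : 0 ≤ g) (hgr : g ≤ r) :
    AEStronglyMeasurable[sigmaField c (pathRange X (Icc 0 r))]
      (fun s => Real.exp (primitive (fieldAlong c η X) g s)) P :=
  Real.continuous_exp.comp_aestronglyMeasurable
    ((isBoundedProcess_fieldAlong hc hη hX).aestronglyMeasurable_integral (hc.sigmaField_le _) hg
      fun _ ha => measurable_fieldAlong_sigmaField ⟨ha.1.le, ha.2.trans hgr⟩)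

theorem abs_integral_mul_fieldAlong_le (hc : IsBoundedField c K)
    (hcentered : ∀ t x, ∫ s, c t x s ∂P = 0) (hη : 0 ≤ η) (hX : Measurable X) {r u : ℝ}
    (hr : 0 ≤ r) (hu : 0 ≤ u) {f : S → ℝ}
    (hf : AEStronglyMeasurable[sigmaField c (pathRange X (Icc 0 r))] f P) (hfi : Integrable f P) :
    |∫ s, f s * fieldAlong c η X (r + u) s ∂P| ≤
      2 * (η * K) * alphaUm P c u * ∫ s, |f s| ∂P := by
  have hfar : FarApart (pathRange X {r + u}) (pathRange X (Icc 0 r)) u := by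
    refine farApart_pathRange ?_ (fun _ hb => hb.1) ?_
    · rintro _ rfl
      exact add_nonneg hr hu
    · rintro _ rfl _ hb
      exact add_le_add_left hb.2 u
  have hcov := (hfar.uniformlyMixing (P := P) hc).abs_integral_mul_sub_le (hc.sigmaField_le _)
    (hc.sigmaField_le _) hf hfi (measurable_fieldAlong_sigmaField (mem_singleton _))
    ((isBoundedProcess_fieldAlong hc hη hX).abs_le _)
  have hzero : ∫ s, fieldAlong c η X (r + u) s ∂P = 0 := by
    simp only [fieldAlong, integral_const_mul, hcentered, mul_zero]
  rwa [hzero, mul_zero, sub_zero] at hcov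

theorem abs_tiltedLagCov_fieldAlong_le (hc : IsBoundedField c K)
    (hcentered : ∀ t x, ∫ s, c t x s ∂P = 0) (hη : 0 ≤ η) (hX : Measurable X) {g r u : ℝ}
    (hg : 0 ≤ g) (hgr : g ≤ r) (hu : 0 ≤ u) :
    |tiltedLagCov P (fieldAlong c η X) g r u| ≤
      2 * (η * K) * (η * K) * alphaUm P c u * expMoment P (fieldAlong c η X) g := by
  have hV := isBoundedProcess_fieldAlong hc hη hX
  have hr : 0 ≤ r := hg.trans hgr
  have hf := (aestronglyMeasurable_exp_primitive_fieldAlong (P := P) hc hη hX hg hgr).mul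
    (measurable_fieldAlong_sigmaField (c := c) (η := η) (X := X)
      (right_mem_Icc.2 hr)).stronglyMeasurable.aestronglyMeasurable
  have hfi := hV.integrable_exp_primitive_mul (P := P) g
    (hV.measurable_apply r) (hV.abs_le r)
  have hmean : ∫ s, |Real.exp (primitive (fieldAlong c η X) g s) * fieldAlong c η X r s| ∂P ≤
      expMoment P (fieldAlong c η X) g * (η * K) := by
    rw [expMoment, ← integral_mul_const]
    refine integral_mono hfi.abs ((hV.integrable_exp_primitive g).mul_const _) fun s => ?_
    simp only [abs_mul, Real.abs_exp]
    exact mul_le_mul_of_nonneg_left (hV.abs_le r s) (Real.exp_pos _).le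
  have hηK : 0 ≤ η * K := by
    have := nonempty_of_isProbabilityMeasure P
    exact hV.bound_nonneg
  calc |tiltedLagCov P (fieldAlong c η X) g r u|
      = |∫ s, Real.exp (primitive (fieldAlong c η X) g s) * fieldAlong c η X r s *
          fieldAlong c η X (r + u) s ∂P| := by simp only [tiltedLagCov, mul_assoc]
    _ ≤ 2 * (η * K) * alphaUm P c u *
          ∫ s, |Real.exp (primitive (fieldAlong c η X) g s) * fieldAlong c η X r s| ∂P :=
        abs_integral_mul_fieldAlong_le hc hcentered hη hX hr hu hf hfi
    _ ≤ 2 * (η * K) * alphaUm P c u * (expMoment P (fieldAlong c η X) g * (η * K)) :=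
        mul_le_mul_of_nonneg_left hmean (mul_nonneg (by positivity) (alphaUm_nonneg u))
    _ = _ := by ring

theorem abs_tiltedLagCov_fieldAlong_sub_le (hc : IsBoundedField c K) (hη : 0 ≤ η)
    (hX : Measurable X) {g r u : ℝ} (hg : 0 ≤ g) (hgr : g ≤ r) (hu : 0 ≤ u) :
    |tiltedLagCov P (fieldAlong c η X) g r u -
        expMoment P (fieldAlong c η X) g * lagCov P (fieldAlong c η X) r u| ≤
      2 * (η * K) * (η * K) * alphaUm P c (r - g) * expMoment P (fieldAlong c η X) g := by
  have hV := isBoundedProcess_fieldAlong hc hη hX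
  have hfar : FarApart (pathRange X {r, r + u}) (pathRange X (Icc 0 g)) (r - g) := by
    refine farApart_pathRange ?_ (fun _ hb => hb.1) ?_
    · rintro _ (rfl | rfl) <;> linarith
    · rintro _ (rfl | rfl) b hb <;> linarith [hb.2]
  have hcov := (hfar.uniformlyMixing (P := P) hc).abs_integral_mul_sub_le (hc.sigmaField_le _)
    (hc.sigmaField_le _) (aestronglyMeasurable_exp_primitive_fieldAlong hc hη hX hg le_rfl)
    (hV.integrable_exp_primitive g)
    ((measurable_fieldAlong_sigmaField (mem_insert r {r + u})).mul
      (measurable_fieldAlong_sigmaField (mem_insert_of_mem r (mem_singleton (r + u)))))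
    (hV.abs_mul_le r (r + u))
  simp only [Real.abs_exp] at hcov
  refine hcov.trans (le_of_eq ?_)
  rw [expMoment]
  ring

/-- The path `X` enters only through its range, and points of the range at times `u` apart are at
distance at least `u`: hence the bounds are uniform in `X`. -/
theorem weaklyDependent_fieldAlong (hc : IsBoundedField c K)
    (hcentered : ∀ t x, ∫ s, c t x s ∂P = 0) (hα : IntegrableOn (alphaUm P c) (Ioi 0))
    (hη : 0 ≤ η) (hX : Measurable X) :
    WeaklyDependent P (fieldAlong c η X) (η * K)
      (fun u => 2 * (η * K) * (η * K) * alphaUm P c u) where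
  toIsBoundedProcess := isBoundedProcess_fieldAlong hc hη hX
  integrableOn := hα.const_mul _
  centered r _ := by simp only [fieldAlong, integral_const_mul, hcentered, mul_zero]
  abs_tiltedLagCov_le _ _ _ hg hgr hu := abs_tiltedLagCov_fieldAlong_le hc hcentered hη hX hg hgr hu
  abs_tiltedLagCov_sub_le _ _ _ hg hgr hu := abs_tiltedLagCov_fieldAlong_sub_le hc hη hX hg hgr hu

end FieldAlong

section Translation

theorem tendsto_integral_norm_translate_sub {G E : Type*} [AddGroup G] [TopologicalSpace G]
    [IsTopologicalAddGroup G] [MeasurableSpace G] [BorelSpace G] {μ : Measure G}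
    [IsLocallyFiniteMeasure μ] [μ.InnerRegularCompactLTTop] [μ.IsAddRightInvariant]
    [NormedAddCommGroup E] {g : G → E} (hg : Integrable g μ) :
    Tendsto (fun y => ∫ z, ‖g (z + y) - g z‖ ∂μ) (𝓝 0) (𝓝 0) := by
  have hmp (y : G) : MeasurePreserving (fun z : G => z + y) μ μ := measurePreserving_add_right μ y
  let T : G → C(G, G) := fun y => ⟨fun z => z + y, by fun_prop⟩
  have hT : Continuous T :=
    (ContinuousMap.curry ⟨fun p : G × G => p.2 + p.1, by fun_prop⟩).continuous
  let τ : G → Lp E 1 μ := fun y => Lp.compMeasurePreserving (T y) (hmp y) (hg.toL1 g)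
  have hτ (y : G) : τ y =ᵐ[μ] fun z => g (z + y) :=
    (Lp.coeFn_compMeasurePreserving _ (hmp y)).trans
      ((hmp y).quasiMeasurePreserving.ae_eq_comp hg.coeFn_toL1)
  have hlim : Tendsto τ (𝓝 0) (𝓝 (τ 0)) :=
    tendsto_const_nhds.compMeasurePreservingLp (hT.tendsto 0) hmp (hmp 0) ENNReal.one_ne_top
  refine (tendsto_iff_norm_sub_tendsto_zero.1 hlim).congr fun y => ?_
  rw [L1.norm_eq_integral_norm]
  refine integral_congr_ae ?_
  filter_upwards [Lp.coeFn_sub (τ y) (τ 0), hτ y, hτ 0] with z hsub hy h0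
  rw [hsub, Pi.sub_apply, hy, h0, add_zero]

theorem tendsto_intervalIntegral_norm_translate_sub {E : Type*} [NormedAddCommGroup E] {g : ℝ → E}
    (hg : LocallyIntegrable g) {a b : ℝ} (hab : a ≤ b) :
    Tendsto (fun y => ∫ z in a..b, ‖g (z + y) - g z‖) (𝓝 0) (𝓝 0) := by
  set f : ℝ → E := (Icc (a - 1) (b + 1)).indicator g with hf
  have hfi : Integrable f :=
    (integrable_indicator_iff measurableSet_Icc).2 (hg.integrableOn_isCompact isCompact_Icc)
  refine squeeze_zero' (Eventually.of_forall fun y =>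
    intervalIntegral.integral_nonneg hab fun z _ => norm_nonneg _) ?_
    (tendsto_integral_norm_translate_sub hfi)
  filter_upwards [Icc_mem_nhds (a := (-1 : ℝ)) (b := 1) (by norm_num) (by norm_num)] with y hy
  have heq : ∫ z in a..b, ‖g (z + y) - g z‖ = ∫ z in a..b, ‖f (z + y) - f z‖ := by
    refine intervalIntegral.integral_congr fun z hz => ?_
    rw [uIcc_of_le hab] at hz
    have hz' : z ∈ Icc (a - 1) (b + 1) := ⟨by linarith [hz.1], by linarith [hz.2]⟩
    have hzy : z + y ∈ Icc (a - 1) (b + 1) :=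
      ⟨by linarith [hz.1, hy.1], by linarith [hz.2, hy.2]⟩
    simp only [hf, indicator_of_mem hz', indicator_of_mem hzy]
  rw [heq, intervalIntegral.integral_of_le hab]
  exact setIntegral_le_integral ((hfi.comp_add_right y).sub hfi).norm
    (Eventually.of_forall fun z => norm_nonneg _)

end Translation

section Correlation

variable {S : Type*} [MeasurableSpace S] {P : Measure S} {c : ℝ≥0 → ℝ → S → ℝ}

theorem Stationary.integral_mul_eq_corr (hstat : Stationary P c) (hc : ∀ t x, Measurable (c t x))
    (s t : ℝ≥0) (y x : ℝ) : ∫ σ, c s y σ * c (t + s) (x + y) σ ∂P = corr P c t x := by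
  have hprod : StronglyMeasurable fun f : ℝ≥0 × ℝ → ℝ => f (0, 0) * f (t, x) :=
    Measurable.stronglyMeasurable (by fun_prop)
  have hshift := integral_map (μ := P)
    (measurable_pi_lambda (fun (σ : S) (p : ℝ≥0 × ℝ) => c (p.1 + s) (p.2 + y) σ)
      fun _ => hc _ _).aemeasurable hprod.aestronglyMeasurable
  rw [hstat s y, integral_map (measurable_pi_lambda _ fun _ => hc _ _).aemeasurable
    hprod.aestronglyMeasurable] at hshift
  simpa only [zero_add, corr] using hshift.symm

theorem Stationary.lagCov_fieldAlong (hstat : Stationary P c) (hc : ∀ t x, Measurable (c t x))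
    (η : ℝ) (X : ℝ → ℝ) {r u : ℝ} (hr : 0 ≤ r) (hu : 0 ≤ u) :
    lagCov P (fieldAlong c η X) r u = η ^ 2 * corr P c u.toNNReal (X (r + u) - X r) := by
  rw [← hstat.integral_mul_eq_corr hc r.toNNReal u.toNNReal (X r), ← integral_const_mul]
  simp only [lagCov, fieldAlong, Real.toNNReal_add hr hu, sub_add_cancel, add_comm u.toNNReal]
  exact integral_congr_ae (Eventually.of_forall fun σ => by ring)

theorem measurable_corr [SFinite P] (hc : Measurable fun p : (ℝ≥0 × ℝ) × S => c p.1.1 p.1.2 p.2) :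
    Measurable (Function.uncurry (corr P c)) := by
  have h0 : Measurable (c 0 0) := hc.comp (measurable_prodMk_left (x := ((0 : ℝ≥0), (0 : ℝ))))
  exact ((h0.comp measurable_snd).mul hc).stronglyMeasurable.integral_prod_right.measurable

variable [IsProbabilityMeasure P] {K : ℝ}

theorem IsBoundedField.integrable_apply (hc : IsBoundedField c K) (t : ℝ≥0) (x : ℝ) :
    Integrable (c t x) P :=
  .of_bound (hc.measurable_apply t x).aestronglyMeasurable K (Eventually.of_forall (hc.abs_le t x))

theorem IsBoundedField.abs_corr_le (hc : IsBoundedField c K) (h0 : ∫ s, c 0 0 s ∂P = 0) {u : ℝ}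
    (hu : 0 ≤ u) (x : ℝ) : |corr P c u.toNNReal x| ≤ 2 * K * K * alphaUm P c u := by
  have hfar : FarApart {(u.toNNReal, x)} {((0 : ℝ≥0), (0 : ℝ))} u := by
    rintro _ rfl _ rfl
    apply Real.le_sqrt_of_sq_le
    simp only [Real.coe_toNNReal u hu, NNReal.coe_zero, sub_zero]
    exact le_add_of_nonneg_right (sq_nonneg x)
  have hcov := (hfar.uniformlyMixing (P := P) hc).abs_integral_mul_sub_le (hc.sigmaField_le _)
    (hc.sigmaField_le _)
    (measurable_sigmaField (mem_singleton _)).stronglyMeasurable.aestronglyMeasurable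
    (hc.integrable_apply 0 0) (measurable_sigmaField (mem_singleton _)) (hc.abs_le u.toNNReal x)
  rw [h0, zero_mul, sub_zero] at hcov
  have hmean : ∫ s, |c 0 0 s| ∂P ≤ K :=
    (le_abs_self _).trans (abs_integral_le_of_abs_le_const fun s =>
      (abs_abs (c 0 0 s)).trans_le (hc.abs_le 0 0 s))
  have := nonempty_of_isProbabilityMeasure P
  calc |corr P c u.toNNReal x| ≤ 2 * K * alphaUm P c u * ∫ s, |c 0 0 s| ∂P := hcov
    _ ≤ 2 * K * alphaUm P c u * K :=
        mul_le_mul_of_nonneg_left hmean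
          (mul_nonneg (mul_nonneg zero_le_two hc.bound_nonneg) (alphaUm_nonneg u))
    _ = 2 * K * K * alphaUm P c u := by ring

theorem IsBoundedField.measurable_abs_sub (hc : IsBoundedField c K) (t : ℝ≥0) (y : ℝ) :
    Measurable (Function.uncurry fun (z : ℝ) (s : S) => |c t (z + y) s - c t z s|) :=
  ((hc.measurable.comp (by fun_prop : Measurable fun p : ℝ × S => ((t, p.1 + y), p.2))).sub
    (hc.measurable.comp (by fun_prop : Measurable fun p : ℝ × S => ((t, p.1), p.2)))).abs

theorem IsBoundedField.abs_abs_sub_le (hc : IsBoundedField c K) (t : ℝ≥0) (x y : ℝ) (s : S) :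
    |(|c t x s - c t y s|)| ≤ 2 * K := by
  rw [abs_abs, two_mul]
  exact (abs_sub _ _).trans (add_le_add (hc.abs_le t x s) (hc.abs_le t y s))

theorem Stationary.abs_corr_sub_le (hstat : Stationary P c) (hc : IsBoundedField c K) (t : ℝ≥0)
    (x y z : ℝ) :
    |corr P c t (x + y) - corr P c t x| ≤ K * ∫ s, |c t (z + y) s - c t z s| ∂P := by
  have hcorr (v : ℝ) : corr P c t (x + v) = ∫ s, c 0 (z - x) s * c t (z + v) s ∂P := by
    rw [← hstat.integral_mul_eq_corr hc.measurable_apply 0 t (z - x) (x + v), add_zero]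
    ring_nf
  have hi (v : ℝ) : Integrable (fun s => c 0 (z - x) s * c t (z + v) s) P :=
    (hc.integrable_apply t _).bdd_mul (hc.measurable_apply 0 _).aestronglyMeasurable
      (Eventually.of_forall (hc.abs_le 0 _))
  have hdi : Integrable (fun s => |c t (z + y) s - c t z s|) P :=
    ((hc.integrable_apply t _).sub (hc.integrable_apply t _)).abs
  have h0 := hcorr 0
  have hi0 := hi 0
  rw [add_zero, add_zero] at h0
  rw [add_zero] at hi0
  rw [hcorr y, h0, ← integral_sub (hi y) hi0, ← integral_const_mul]
  refine abs_integral_le_of_abs_le (hdi.const_mul K) (Eventually.of_forall fun s => ?_)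
  rw [← mul_sub, abs_mul]
  exact mul_le_mul_of_nonneg_right (hc.abs_le 0 _ s) (abs_nonneg _)

/-- Averaging the previous bound over `z` brings in the continuity of translations in `L¹`. -/
theorem Stationary.abs_corr_sub_le_integral (hstat : Stationary P c) (hc : IsBoundedField c K)
    (t : ℝ≥0) (x y : ℝ) :
    |corr P c t (x + y) - corr P c t x| ≤
      K * ∫ s, (∫ z in (0 : ℝ)..1, |c t (z + y) s - c t z s|) ∂P := by
  rw [integral_intervalIntegral_swap (hc.measurable_abs_sub t y) zero_le_one
      (fun z _ s => hc.abs_abs_sub_le t (z + y) z s), ← intervalIntegral.integral_const_mul]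
  have hint : IntervalIntegrable (fun z => ∫ s, |c t (z + y) s - c t z s| ∂P) volume 0 1 :=
    intervalIntegrable_iff.2 (Measure.integrableOn_of_bounded (M := 2 * K) (by simp)
      (hc.measurable_abs_sub t y).stronglyMeasurable.integral_prod_right.aestronglyMeasurable
      (Eventually.of_forall fun z =>
        abs_integral_le_of_abs_le_const (hc.abs_abs_sub_le t (z + y) z)))
  simpa only [intervalIntegral.integral_const, sub_zero, one_smul] using
    intervalIntegral.integral_mono_on zero_le_one intervalIntegrable_const (hint.const_mul K)
      fun z _ => hstat.abs_corr_sub_le hc t x y z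

theorem IsBoundedField.tendsto_integral_abs_translate_sub (hc : IsBoundedField c K) (t : ℝ≥0) :
    Tendsto (fun y => ∫ s, (∫ z in (0 : ℝ)..1, |c t (z + y) s - c t z s|) ∂P) (𝓝 0) (𝓝 0) := by
  have hlim : Tendsto (fun y => ∫ s, (∫ z in (0 : ℝ)..1, |c t (z + y) s - c t z s|) ∂P) (𝓝 0)
      (𝓝 (∫ _, (0 : ℝ) ∂P)) := by
    refine tendsto_integral_filter_of_dominated_convergence (fun _ => 2 * K)
      (Eventually.of_forall fun y => ?_) (Eventually.of_forall fun y =>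
        Eventually.of_forall fun s => ?_) (integrable_const _) (Eventually.of_forall fun s => ?_)
    · simp only [intervalIntegral.integral_of_le zero_le_one]
      exact ((hc.measurable_abs_sub t y).comp
        measurable_swap).stronglyMeasurable.integral_prod_right'.aestronglyMeasurable
    · simpa only [sub_zero, abs_one, mul_one] using
        intervalIntegral.norm_integral_le_of_norm_le_const (a := 0) (b := 1)
          (f := fun z => |c t (z + y) s - c t z s|) (C := 2 * K)
          fun z _ => hc.abs_abs_sub_le t (z + y) z s
    · have hloc : LocallyIntegrable fun z => c t z s :=
        (locallyIntegrable_const K).mono (hc.measurable.comp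
          (by fun_prop : Measurable fun z : ℝ => ((t, z), s))).aestronglyMeasurable
          (Eventually.of_forall fun z => (hc.abs_le t z s).trans (le_abs_self K))
      exact tendsto_intervalIntegral_norm_translate_sub hloc zero_le_one
  rwa [integral_zero] at hlim

theorem Stationary.continuous_corr (hstat : Stationary P c) (hc : IsBoundedField c K) (t : ℝ≥0) :
    Continuous (corr P c t) := by
  refine continuous_iff_continuousAt.2 fun x => tendsto_iff_norm_sub_tendsto_zero.2 ?_
  have hsub : Tendsto (fun x' => x' - x) (𝓝 x) (𝓝 0) := by
    simpa only [sub_self] using (continuous_sub_right x).tendsto x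
  have hlim := ((hc.tendsto_integral_abs_translate_sub (P := P) t).comp hsub).const_mul K
  rw [mul_zero] at hlim
  refine squeeze_zero (fun _ => norm_nonneg _) (fun x' => ?_) hlim
  simpa only [add_sub_cancel, Real.norm_eq_abs, Function.comp_apply] using
    hstat.abs_corr_sub_le_integral hc t x (x' - x)

theorem antitone_alphaUm : Antitone (alphaUm P c) := by
  intro a b hab
  refine csSup_le_csSup (bddAbove_mixingDefects P c a) ⟨0, zero_mem_mixingDefects P c b⟩ ?_
  rintro x ⟨A₁, A₂, hA, h⟩
  exact ⟨A₁, A₂, fun p hp q hq => hab.trans (hA p hp q hq), h⟩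

theorem HUm.integrableOn_alphaUm (h : HUm P c) : IntegrableOn (alphaUm P c) (Ioi 0) := by
  obtain ⟨C, δ, -, hδ, h⟩ := h
  have hint : IntegrableOn (fun u : ℝ => C * (u + 1) ^ (-(2 + δ))) (Ioi 0) :=
    (integrableOn_add_rpow_Ioi_of_lt (by linarith) (by norm_num)).const_mul C
  refine hint.mono' antitone_alphaUm.measurable.aestronglyMeasurable ?_
  filter_upwards [ae_restrict_mem measurableSet_Ioi] with u hu
  rw [Real.norm_eq_abs, abs_of_nonneg (alphaUm_nonneg u), add_comm u 1]
  exact h u (le_of_lt hu)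

end Correlation

section Averaging

theorem abs_intervalIntegral_le_of_eq_zero_of_le_abs_sub {f : ℝ → ℝ} {a b r ℓ D : ℝ} (hab : a ≤ b)
    (hℓ : 0 ≤ ℓ) (hD : ∀ r', |f r'| ≤ D) (hf : ∀ r' ∈ Ioc a b, ℓ ≤ |r' - r| → f r' = 0) :
    |∫ r' in a..b, f r'| ≤ D * (2 * ℓ) := by
  set g : ℝ → ℝ := (Ioo (r - ℓ) (r + ℓ)).indicator fun _ => D with hg
  have hgi : Integrable g :=
    (integrable_indicator_iff measurableSet_Ioo).2 (integrableOn_const (by simp))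
  have hg0 (r' : ℝ) : 0 ≤ g r' := indicator_nonneg (fun _ _ => (abs_nonneg _).trans (hD 0)) r'
  have hfg : ∀ r' ∈ Ioc a b, |f r'| ≤ g r' := by
    intro r' hr'
    by_cases hnear : r' ∈ Ioo (r - ℓ) (r + ℓ)
    · rw [hg, indicator_of_mem hnear]
      exact hD r'
    · have hfar : ℓ ≤ |r' - r| := by
        rw [← not_lt, abs_lt]
        exact fun h => hnear ⟨by linarith [h.1], by linarith [h.2]⟩
      rw [hf r' hr' hfar, abs_zero]
      exact hg0 r'
  calc |∫ r' in a..b, f r'| ≤ ∫ r' in a..b, g r' :=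
        abs_intervalIntegral_le_of_abs_le hab hgi.intervalIntegrable hfg
    _ ≤ ∫ r', g r' := by
        rw [intervalIntegral.integral_of_le hab]
        exact setIntegral_le_integral hgi (Eventually.of_forall hg0)
    _ = D * (2 * ℓ) := by
        rw [hg, integral_indicator measurableSet_Ioo, setIntegral_const, smul_eq_mul,
          Real.volume_real_Ioo_of_le (by linarith)]
        ring

variable {Ω : Type*} [MeasurableSpace Ω] {Q : Measure Ω} [IsProbabilityMeasure Q]
  {Y : ℝ → Ω → ℝ} {D t : ℝ}

theorem sq_integral_abs_le_integral_sq {f : Ω → ℝ} (hf : MemLp f 2 Q) :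
    (∫ ω, |f ω| ∂Q) ^ 2 ≤ ∫ ω, f ω ^ 2 ∂Q := by
  have habs : MemLp (fun ω => |f ω|) 2 Q := hf.abs
  have hvar := variance_nonneg (fun ω => |f ω|) Q
  rw [variance_eq_sub habs] at hvar
  simpa only [Pi.pow_apply, sq_abs] using sub_nonneg.1 hvar

namespace IsBoundedProcess

theorem integral_abs_primitive_le (h : IsBoundedProcess Y D) (ht : 0 ≤ t) :
    ∫ ω, |primitive Y t ω| ∂Q ≤ ∫ r in 0..t, ∫ ω, |Y r ω| ∂Q := by
  have habs : IsBoundedProcess (fun r ω => |Y r ω|) D :=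
    ⟨h.measurable.abs, fun r ω => (abs_abs _).trans_le (h.abs_le r ω)⟩
  rw [← integral_intervalIntegral_swap habs.measurable ht fun r _ => habs.abs_le r]
  exact integral_mono_of_nonneg (Eventually.of_forall fun ω => abs_nonneg _)
    (habs.integrable_primitive t)
    (Eventually.of_forall fun ω => intervalIntegral.abs_integral_le_integral_abs ht)

theorem integral_sq_primitive (h : IsBoundedProcess Y D) (ht : 0 ≤ t) :
    ∫ ω, primitive Y t ω ^ 2 ∂Q = ∫ r in 0..t, ∫ r' in 0..t, ∫ ω, Y r ω * Y r' ω ∂Q := by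
  have hinner (r : ℝ) :
      ∫ ω, Y r ω * primitive Y t ω ∂Q = ∫ r' in 0..t, ∫ ω, Y r ω * Y r' ω ∂Q := by
    rw [← integral_intervalIntegral_swap
      (((h.measurable_apply r).comp measurable_snd).mul h.measurable) ht
      fun r' _ => h.abs_mul_le r r']
    simp only [primitive, intervalIntegral.integral_const_mul]
  have hswap := integral_intervalIntegral_swap (P := Q)
    (f := fun r ω => Y r ω * primitive Y t ω)
    (h.measurable.mul ((h.measurable_primitive_apply t).comp measurable_snd)) ht
    (C := D * (D * |t|)) fun r _ ω => by
      rw [abs_mul]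
      exact mul_le_mul (h.abs_le r ω) (h.abs_primitive_le t ω) (abs_nonneg _)
        ((abs_nonneg _).trans (h.abs_le r ω))
  simp only [← hinner]
  refine Eq.trans (integral_congr_ae (Eventually.of_forall fun ω => ?_)) hswap
  simp [primitive, pow_two]

theorem sq_integral_abs_primitive_le (h : IsBoundedProcess Y D) (ht : 0 ≤ t) {ℓ : ℝ} (hℓ : 0 ≤ ℓ)
    (h0 : ∀ r r', 0 ≤ r → r + ℓ ≤ r' → ∫ ω, Y r ω * Y r' ω ∂Q = 0) :
    (∫ ω, |primitive Y t ω| ∂Q) ^ 2 ≤ D * D * (2 * ℓ) * t := by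
  have hmem : MemLp (primitive Y t) 2 Q :=
    .of_bound (h.measurable_primitive_apply t).aestronglyMeasurable (D * |t|)
      (Eventually.of_forall (h.abs_primitive_le t))
  have hinner : ∀ r ∈ Ioc 0 t, |∫ r' in 0..t, ∫ ω, Y r ω * Y r' ω ∂Q| ≤ D * D * (2 * ℓ) := by
    intro r hr
    refine abs_intervalIntegral_le_of_eq_zero_of_le_abs_sub (r := r) ht hℓ
      (fun r' => abs_integral_le_of_abs_le_const (h.abs_mul_le r r')) fun r' hr' hfar => ?_
    rcases le_abs.1 hfar with hlt | hgt
    · exact h0 r r' hr.1.le (by linarith)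
    · simp only [mul_comm (Y r _)]
      exact h0 r' r hr'.1.le (by linarith)
  calc (∫ ω, |primitive Y t ω| ∂Q) ^ 2 ≤ ∫ ω, primitive Y t ω ^ 2 ∂Q :=
        sq_integral_abs_le_integral_sq hmem
    _ ≤ |∫ r in 0..t, ∫ r' in 0..t, ∫ ω, Y r ω * Y r' ω ∂Q| := by
        rw [h.integral_sq_primitive ht]
        exact le_abs_self _
    _ ≤ ∫ _ in 0..t, D * D * (2 * ℓ) :=
        abs_intervalIntegral_le_of_abs_le ht intervalIntegrable_const hinner
    _ = D * D * (2 * ℓ) * t := by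
        rw [intervalIntegral.integral_const, sub_zero, smul_eq_mul, mul_comm]

end IsBoundedProcess

end Averaging

section BrownianIncrements

variable {Ω : Type*} [MeasurableSpace Ω] {Q : Measure Ω} {B : ℝ≥0 → Ω → ℝ} {β ε r u : ℝ}

/-- The increment of the path `B` between the times `r` and `r + ε u`, in the space scale `ε ^ β`
of the random field. -/
noncomputable def scaledIncrement (B : ℝ≥0 → Ω → ℝ) (β ε r u : ℝ) (ω : Ω) : ℝ :=
  (B (r + ε * u).toNNReal ω - B r.toNNReal ω) / ε ^ β

theorem measurable_scaledIncrement (hB : Measurable (Function.uncurry B)) (β ε : ℝ) :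
    Measurable fun p : (ℝ × ℝ) × Ω => scaledIncrement B β ε p.1.1 p.1.2 p.2 :=
  ((hB.comp (by fun_prop : Measurable fun p : (ℝ × ℝ) × Ω =>
    ((p.1.1 + ε * p.1.2).toNNReal, p.2))).sub
    (hB.comp (by fun_prop : Measurable fun p : (ℝ × ℝ) × Ω =>
      (p.1.1.toNNReal, p.2)))).div_const _

theorem integral_comp_scaledIncrement (hB : IsPreBrownianReal B Q) (hε : 0 < ε) (hr : 0 ≤ r)
    (hu : 0 ≤ u) {f : ℝ → ℝ} (hf : Measurable f) :
    ∫ ω, f (scaledIncrement B β ε r u ω) ∂Q = ∫ ω, f (ε ^ (1 / 2 - β) * B u.toNNReal ω) ∂Q := by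
  have hg : Measurable fun y : ℝ => f (ε ^ (1 / 2 - β) * y) := hf.comp (measurable_const_mul _)
  have hscaling := ((hB.shift r.toNNReal).smul (Real.toNNReal_pos.2 hε).ne').hasLaw_eval u.toNNReal
  refine Eq.trans (integral_congr_ae (Eventually.of_forall fun ω => ?_))
    ((hscaling.integral_comp hg.aestronglyMeasurable).trans
      ((hB.hasLaw_eval u.toNNReal).integral_comp hg.aestronglyMeasurable).symm)
  simp only [Function.comp_apply, scaledIncrement]
  congr 1
  rw [Real.toNNReal_add hr (mul_nonneg hε.le hu), Real.toNNReal_mul hε.le,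
    Real.coe_toNNReal ε hε.le, Real.rpow_sub hε, ← Real.sqrt_eq_rpow]
  have : √ε ≠ 0 := (Real.sqrt_pos.2 hε).ne'
  field_simp

theorem indepFun_scaledIncrement (hB : IsPreBrownianReal B Q) {r' : ℝ} (hr : 0 ≤ r)
    (hεu : 0 ≤ ε * u) (hr' : r + ε * u ≤ r') :
    IndepFun (scaledIncrement B β ε r u) (scaledIncrement B β ε r' u) Q := by
  have hr₁ : r.toNNReal ≤ r'.toNNReal := Real.toNNReal_le_toNNReal (by linarith)
  have hr₂ : (r + ε * u).toNNReal ≤ r'.toNNReal := Real.toNNReal_le_toNNReal hr'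
  have hindep := (hB.indepFun_shift r'.toNNReal).symm.comp
    (φ := fun g : Iic r'.toNNReal → ℝ =>
      (g ⟨(r + ε * u).toNNReal, hr₂⟩ - g ⟨r.toNNReal, hr₁⟩) / ε ^ β)
    (ψ := fun g : ℝ≥0 → ℝ => g (ε * u).toNNReal / ε ^ β) (by fun_prop) (by fun_prop)
  have hshift : scaledIncrement B β ε r' u = (fun g : ℝ≥0 → ℝ => g (ε * u).toNNReal / ε ^ β) ∘
      fun ω t => B (r'.toNNReal + t) ω - B r'.toNNReal ω := by
    funext ω
    simp only [Function.comp_apply, scaledIncrement,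
      Real.toNNReal_add (by linarith : 0 ≤ r') hεu]
  rw [hshift]
  exact hindep

variable {f : ℝ → ℝ} {D t : ℝ}

theorem isBoundedProcess_comp_scaledIncrement (hBm : Measurable (Function.uncurry B))
    (hf : Measurable f) (hD : ∀ x, |f x| ≤ D) (β ε u : ℝ) :
    IsBoundedProcess (fun r ω => f (scaledIncrement B β ε r u ω)) D where
  measurable := hf.comp ((measurable_scaledIncrement hBm β ε).comp
    (by fun_prop : Measurable fun p : ℝ × Ω => ((p.1, u), p.2)))
  abs_le _ _ := hD _

variable [IsProbabilityMeasure Q]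

theorem tendsto_integral_abs_comp_mul {X : Ω → ℝ} (hX : AEMeasurable X Q) (hf : Measurable f)
    (hD : ∀ x, |f x| ≤ D) (hf0 : Tendsto f (𝓝 0) (𝓝 0)) :
    Tendsto (fun a : ℝ => ∫ ω, |f (a * X ω)| ∂Q) (𝓝 0) (𝓝 0) := by
  have hlim : Tendsto (fun a : ℝ => ∫ ω, |f (a * X ω)| ∂Q) (𝓝 0) (𝓝 (∫ _, (0 : ℝ) ∂Q)) := by
    refine tendsto_integral_filter_of_dominated_convergence (fun _ => D)
      (Eventually.of_forall fun a =>
        (hf.comp_aemeasurable (hX.const_mul a)).abs.aestronglyMeasurable)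
      (Eventually.of_forall fun a => Eventually.of_forall fun ω => ?_) (integrable_const _)
      (Eventually.of_forall fun ω => ?_)
    · rw [Real.norm_eq_abs, abs_abs]
      exact hD _
    · have hmul : Tendsto (fun a : ℝ => a * X ω) (𝓝 0) (𝓝 0) := by
        simpa only [zero_mul] using (continuous_mul_const (X ω)).tendsto 0
      simpa only [abs_zero, Function.comp_apply] using (hf0.comp hmul).abs
  rwa [integral_zero] at hlim

theorem tendsto_integral_abs_primitive_of_lt (hB : IsPreBrownianReal B Q)
    (hBm : Measurable (Function.uncurry B)) (hβ : β < 1 / 2) (ht : 0 ≤ t) (hu : 0 ≤ u)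
    (hf : Measurable f) (hD : ∀ x, |f x| ≤ D) (hf0 : Tendsto f (𝓝 0) (𝓝 0)) :
    Tendsto (fun ε => ∫ ω, |primitive (fun r ω => f (scaledIncrement B β ε r u ω)) t ω| ∂Q)
      (𝓝[>] 0) (𝓝 0) := by
  have hpow : Tendsto (fun ε : ℝ => ε ^ (1 / 2 - β)) (𝓝[>] 0) (𝓝 0) := by
    have hcont : ContinuousAt (fun ε : ℝ => ε ^ (1 / 2 - β)) 0 :=
      Real.continuousAt_rpow_const _ _ (Or.inr (by linarith))
    simpa only [Real.zero_rpow (sub_pos.2 hβ).ne'] using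
      hcont.tendsto.mono_left (nhdsWithin_le_nhds (s := Ioi 0))
  have hlim := ((tendsto_integral_abs_comp_mul (hB.aemeasurable u.toNNReal) hf hD hf0).comp
    hpow).const_mul t
  rw [mul_zero] at hlim
  refine squeeze_zero' (Eventually.of_forall fun ε => integral_nonneg fun ω => abs_nonneg _) ?_ hlim
  filter_upwards [self_mem_nhdsWithin] with ε hε
  refine ((isBoundedProcess_comp_scaledIncrement hBm hf hD β ε u).integral_abs_primitive_le
    ht).trans_eq ?_
  rw [intervalIntegral.integral_congr
    (g := fun _ => ∫ ω, |f (ε ^ (1 / 2 - β) * B u.toNNReal ω)| ∂Q) fun r hr => ?_]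
  · rw [intervalIntegral.integral_const, sub_zero, smul_eq_mul, Function.comp_apply]
  · rw [uIcc_of_le ht] at hr
    exact integral_comp_scaledIncrement hB hε hr.1 hu hf.abs

theorem tendsto_integral_abs_primitive_half (hB : IsPreBrownianReal B Q)
    (hBm : Measurable (Function.uncurry B)) (ht : 0 ≤ t) (hu : 0 ≤ u) (hf : Measurable f)
    (hD : ∀ x, |f x| ≤ D) (hf0 : ∫ ω, f (B u.toNNReal ω) ∂Q = 0) :
    Tendsto (fun ε => ∫ ω, |primitive (fun r ω => f (scaledIncrement B (1 / 2) ε r u ω)) t ω| ∂Q)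
      (𝓝[>] 0) (𝓝 0) := by
  have hlim : Tendsto (fun ε : ℝ => √(D * D * (2 * (ε * u)) * t)) (𝓝[>] 0) (𝓝 0) := by
    have hcont : Continuous fun ε : ℝ => √(D * D * (2 * (ε * u)) * t) := by fun_prop
    simpa using (hcont.tendsto 0).mono_left (nhdsWithin_le_nhds (s := Ioi 0))
  refine squeeze_zero' (Eventually.of_forall fun ε => integral_nonneg fun ω => abs_nonneg _) ?_ hlim
  filter_upwards [self_mem_nhdsWithin] with ε (hε : 0 < ε)
  have hproc := isBoundedProcess_comp_scaledIncrement hBm hf hD (1 / 2) ε u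
  have hεu : 0 ≤ ε * u := mul_nonneg hε.le hu
  refine Real.le_sqrt_of_sq_le (hproc.sq_integral_abs_primitive_le ht hεu fun r r' hr hrr' => ?_)
  have hmean : ∫ ω, f (scaledIncrement B (1 / 2) ε r u ω) ∂Q = 0 := by
    rw [integral_comp_scaledIncrement hB hε hr hu hf]
    simpa only [sub_self, Real.rpow_zero, one_mul] using hf0
  refine (((indepFun_scaledIncrement hB hr hεu hrr').comp hf hf).integral_mul_eq_mul_integral
    (hproc.measurable_apply r).aestronglyMeasurable
    (hproc.measurable_apply r').aestronglyMeasurable).trans (mul_eq_zero_of_left hmean _)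

end BrownianIncrements

section ErrorLimit

variable {θ : ℝ → ℝ}

theorem tendsto_atTop_zero_of_antitone_of_integrableOn (hanti : Antitone θ) (hθ0 : ∀ u, 0 ≤ θ u)
    (hθ : IntegrableOn θ (Ioi 0)) : Tendsto θ atTop (𝓝 0) := by
  refine squeeze_zero' (Eventually.of_forall hθ0) ?_
    (tendsto_integral_Ioi_zero (f := θ) (μ := volume)
      (tendsto_atTop_add_const_right atTop (-1 : ℝ) tendsto_id))
  filter_upwards [eventually_ge_atTop 1] with x hx
  have hint : IntegrableOn θ (Ioi (x + -1)) := hθ.mono_set (Ioi_subset_Ioi (by linarith))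
  calc θ x = ∫ _ in Ioc (x + -1) x, θ x := by simp
    _ ≤ ∫ u in Ioc (x + -1) x, θ u :=
        setIntegral_mono_on (integrableOn_const (by simp)) (hint.mono_set Ioc_subset_Ioi_self)
          measurableSet_Ioc fun u hu => hanti hu.2
    _ ≤ ∫ u in Ioi (x + -1), θ u :=
        setIntegral_mono_set hint (Eventually.of_forall hθ0) Ioc_subset_Ioi_self.eventuallyLE

theorem tendsto_setIntegral_min {ι : Type*} {l : Filter ι} [l.IsCountablyGenerated] {a : ι → ℝ}
    {s : Set ℝ} (hs : MeasurableSet s) (hθ0 : ∀ u ∈ s, 0 ≤ θ u) (hθ : IntegrableOn θ s)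
    (ha0 : ∀ᶠ i in l, 0 ≤ a i) (ha : Tendsto a l (𝓝 0)) :
    Tendsto (fun i => ∫ u in s, min (θ u) (a i)) l (𝓝 0) := by
  have hlim : Tendsto (fun i => ∫ u in s, min (θ u) (a i)) l (𝓝 (∫ _ in s, (0 : ℝ))) := by
    refine tendsto_integral_filter_of_dominated_convergence θ
      (Eventually.of_forall fun i => hθ.aestronglyMeasurable.inf aestronglyMeasurable_const) ?_ hθ
      ?_
    · filter_upwards [ha0] with i hi
      filter_upwards [ae_restrict_mem hs] with u hu
      rw [Real.norm_eq_abs, abs_of_nonneg (le_min (hθ0 u hu) hi)]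
      exact min_le_left _ _
    · filter_upwards [ae_restrict_mem hs] with u hu
      simpa only [min_eq_right (hθ0 u hu)] using (tendsto_const_nhds (x := θ u)).min ha
  rwa [integral_zero] at hlim

theorem tendsto_intervalIntegral_setIntegral_Ioi_div (hθ0 : ∀ u ∈ Ioi 0, 0 ≤ θ u)
    (hθ : IntegrableOn θ (Ioi 0)) {t : ℝ} (ht : 0 ≤ t) :
    Tendsto (fun ε : ℝ => ∫ r in 0..t, ∫ u in Ioi (r / ε), θ u) (𝓝[>] 0) (𝓝 0) := by
  have hanti := antitoneOn_setIntegral_Ioi hθ hθ0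
  have hlim : Tendsto (fun ε : ℝ => ∫ r in 0..t, ∫ u in Ioi (r / ε), θ u) (𝓝[>] 0)
      (𝓝 (∫ _ in 0..t, (0 : ℝ))) := by
    refine intervalIntegral.tendsto_integral_filter_of_dominated_convergence
      (fun _ => ∫ u in Ioi (0 : ℝ), θ u) ?_ ?_ intervalIntegrable_const ?_
    all_goals rw [uIoc_of_le ht]
    · filter_upwards [self_mem_nhdsWithin] with ε (hε : 0 < ε)
      refine (aemeasurable_restrict_of_antitoneOn measurableSet_Ioc fun r hr r' hr' hrr' =>
        hanti (div_nonneg hr.1.le hε.le) (div_nonneg hr'.1.le hε.le) ?_).aestronglyMeasurable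
      gcongr
    · filter_upwards [self_mem_nhdsWithin] with ε (hε : 0 < ε)
      refine Eventually.of_forall fun r hr => ?_
      have hr' : 0 ≤ r / ε := div_nonneg hr.1.le hε.le
      rw [Real.norm_eq_abs, abs_of_nonneg (setIntegral_nonneg measurableSet_Ioi fun u hu =>
        hθ0 u (hr'.trans_lt hu))]
      exact hanti self_mem_Ici hr' hr'
    · exact Eventually.of_forall fun r hr =>
        tendsto_integral_Ioi_zero (tendsto_inv_nhdsGT_zero.const_mul_atTop hr.1)
  rwa [intervalIntegral.integral_zero] at hlim

theorem gapError_sqrt_mul (K L : ℝ) (θ : ℝ → ℝ) {ε : ℝ} (hε : 0 ≤ ε) :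
    gapError (√ε * K) L (fun u => ε * θ u) =
      ε * (2 * (K * K * (Real.exp (K * (√ε * L)) - 1)) + θ L) := by
  have hsq : √ε * K * (√ε * K) = ε * (K * K) := by
    rw [mul_mul_mul_comm, Real.mul_self_sqrt hε]
  rw [gapError, hsq]
  ring_nf

theorem comparisonError_sqrt_mul (K L t : ℝ) (θ : ℝ → ℝ) {ε : ℝ} (hε : 0 < ε) :
    comparisonError (√ε * K) L (t / ε) (fun u => ε * θ u) =
      t * (∫ u in Ioi (0 : ℝ),
        min (2 * θ u) (2 * (K * K * (Real.exp (K * (√ε * L)) - 1)) + θ L)) +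
        ∫ r in 0..t, ∫ u in Ioi (r / ε), θ u := by
  have htail : ∫ r in 0..t, ∫ u in Ioi (r / ε), θ u =
      ε * ∫ r in 0..t / ε, ∫ u in Ioi r, θ u := by
    rw [intervalIntegral.integral_comp_div (fun r => ∫ u in Ioi r, θ u) hε.ne', zero_div,
      smul_eq_mul]
  simp only [comparisonError, gapError_sqrt_mul K L θ hε.le, mul_left_comm (2 : ℝ) ε,
    ← mul_min_of_nonneg _ _ hε.le, integral_const_mul, intervalIntegral.integral_const_mul, htail]
  rw [← mul_assoc, div_mul_cancel₀ t hε.ne']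

/-- The gap `ε ^ (-1 / 4)` grows, but more slowly than the time `ε ^ (-1 / 2)` in which the process
of size `√ε` changes its exponential appreciably. -/
theorem tendsto_comparisonError (hθ0 : ∀ u, 0 ≤ u → 0 ≤ θ u) (hθ : IntegrableOn θ (Ioi 0))
    (hθlim : Tendsto θ atTop (𝓝 0)) {K t : ℝ} (hK : 0 ≤ K) (ht : 0 ≤ t) :
    Tendsto (fun ε : ℝ =>
      comparisonError (√ε * K) (ε ^ (-(1 / 4) : ℝ)) (t / ε) fun u => ε * θ u) (𝓝[>] 0) (𝓝 0) := by
  set gap : ℝ → ℝ := fun ε => 2 * (K * K * (Real.exp (K * (√ε * ε ^ (-(1 / 4) : ℝ))) - 1)) +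
    θ (ε ^ (-(1 / 4) : ℝ))
  have hsqrt : Tendsto (fun ε : ℝ => √ε * ε ^ (-(1 / 4) : ℝ)) (𝓝[>] 0) (𝓝 0) := by
    have hcont : ContinuousAt (fun ε : ℝ => ε ^ (1 / 4 : ℝ)) 0 :=
      Real.continuousAt_rpow_const _ _ (Or.inr (by norm_num))
    have hlim := hcont.tendsto.mono_left (nhdsWithin_le_nhds (s := Ioi 0))
    rw [Real.zero_rpow (by norm_num)] at hlim
    refine hlim.congr' ?_
    filter_upwards [self_mem_nhdsWithin] with ε (hε : 0 < ε)
    rw [Real.sqrt_eq_rpow, ← Real.rpow_add hε]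
    norm_num
  have hgap : Tendsto gap (𝓝[>] 0) (𝓝 0) := by
    have hlim := ((((hsqrt.const_mul K).rexp.sub_const 1).const_mul (K * K)).const_mul 2).add
      (hθlim.comp (tendsto_rpow_neg_nhdsGT_zero (y := -(1 / 4)) (by norm_num)))
    simp only [mul_zero, Real.exp_zero, sub_self, add_zero] at hlim
    exact hlim
  have hgap0 : ∀ᶠ ε in 𝓝[>] 0, 0 ≤ gap ε := by
    filter_upwards [self_mem_nhdsWithin] with ε (hε : 0 < ε)
    have hexp := Real.one_le_exp (by positivity : 0 ≤ K * (√ε * ε ^ (-(1 / 4) : ℝ)))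
    exact add_nonneg (mul_nonneg zero_le_two (mul_nonneg (mul_nonneg hK hK) (sub_nonneg.2 hexp)))
      (hθ0 _ (Real.rpow_nonneg hε.le _))
  have hmin := tendsto_setIntegral_min measurableSet_Ioi
    (fun u hu => mul_nonneg zero_le_two (hθ0 u (le_of_lt hu))) (hθ.const_mul 2) hgap0 hgap
  have htail := tendsto_intervalIntegral_setIntegral_Ioi_div
    (fun u hu => hθ0 u (le_of_lt hu)) hθ ht
  have hlim := (hmin.const_mul t).add htail
  rw [mul_zero, add_zero] at hlim
  refine hlim.congr' ?_
  filter_upwards [self_mem_nhdsWithin] with ε hε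
    using (comparisonError_sqrt_mul K _ t θ hε).symm

end ErrorLimit

section IntegralsOfProcesses

variable {Ω : Type*} [MeasurableSpace Ω] {Q : Measure Ω}

theorem tendstoInMeasure_zero_of_tendsto_integral_abs {ι : Type*} {l : Filter ι} {f : ι → Ω → ℝ}
    (hf : ∀ i, Integrable (f i) Q) (hlim : Tendsto (fun i => ∫ ω, |f i ω| ∂Q) l (𝓝 0)) :
    TendstoInMeasure Q f l 0 := by
  refine tendstoInMeasure_of_tendsto_eLpNorm one_ne_zero
    (fun i => (hf i).aestronglyMeasurable) aestronglyMeasurable_zero ?_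
  have hnorm (i : ι) : eLpNorm (f i - 0) 1 Q = ENNReal.ofReal (∫ ω, |f i ω| ∂Q) := by
    rw [sub_zero, eLpNorm_one_eq_lintegral_enorm, ← ofReal_integral_norm_eq_lintegral_enorm (hf i)]
    simp only [Real.norm_eq_abs]
  simpa only [hnorm, ENNReal.ofReal_zero] using ENNReal.tendsto_ofReal hlim

variable [IsProbabilityMeasure Q]

theorem integrable_swap_of_abs_le {α : Type*} [MeasurableSpace α] {μ : Measure α} [SFinite μ]
    {H : α → Ω → ℝ} (hH : Measurable (Function.uncurry H)) {g : α → ℝ} (hg : Integrable g μ)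
    (hHg : ∀ᵐ a ∂μ, ∀ ω, |H a ω| ≤ g a) :
    Integrable (Function.uncurry fun (ω : Ω) (a : α) => H a ω) (Q.prod μ) := by
  refine (hg.comp_snd Q).mono' (hH.comp measurable_swap).aestronglyMeasurable ?_
  filter_upwards [Measure.quasiMeasurePreserving_snd.ae hHg] with p hp using hp p.1

theorem integral_abs_integral_le {α : Type*} [MeasurableSpace α] {μ : Measure α} [SFinite μ]
    {H : α → Ω → ℝ} (hH : Integrable (Function.uncurry fun (ω : Ω) (a : α) => H a ω) (Q.prod μ)) :
    ∫ ω, |∫ a, H a ω ∂μ| ∂Q ≤ ∫ a, ∫ ω, |H a ω| ∂Q ∂μ := by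
  rw [← integral_integral_swap hH.abs]
  exact integral_mono_of_nonneg (Eventually.of_forall fun ω => abs_nonneg _)
    hH.abs.integral_prod_left (Eventually.of_forall fun ω => abs_integral_le_integral_abs)

theorem tendstoInMeasure_integral_zero {α ι : Type*} [MeasurableSpace α] {μ : Measure α} [SFinite μ]
    {l : Filter ι} [l.IsCountablyGenerated] {H : ι → α → Ω → ℝ}
    (hH : ∀ i, Measurable (Function.uncurry (H i))) {g : α → ℝ} (hg : Integrable g μ)
    (hHg : ∀ i, ∀ᵐ a ∂μ, ∀ ω, |H i a ω| ≤ g a)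
    (hlim : ∀ᵐ a ∂μ, Tendsto (fun i => ∫ ω, |H i a ω| ∂Q) l (𝓝 0)) :
    TendstoInMeasure Q (fun i ω => ∫ a, H i a ω ∂μ) l 0 := by
  have hint (i : ι) := integrable_swap_of_abs_le (Q := Q) (hH i) hg (hHg i)
  have hdom : Tendsto (fun i => ∫ a, ∫ ω, |H i a ω| ∂Q ∂μ) l (𝓝 (∫ _, (0 : ℝ) ∂μ)) := by
    refine tendsto_integral_filter_of_dominated_convergence g (Eventually.of_forall fun i =>
      ((hH i).abs.stronglyMeasurable.integral_prod_right (ν := Q)).aestronglyMeasurable)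
      (Eventually.of_forall fun i => ?_) hg hlim
    filter_upwards [hHg i] with a ha
      using abs_integral_le_of_abs_le_const fun ω => (abs_abs (H i a ω)).trans_le (ha ω)
  rw [integral_zero] at hdom
  exact tendstoInMeasure_zero_of_tendsto_integral_abs (fun i => (hint i).integral_prod_left)
    (squeeze_zero (fun i => integral_nonneg fun ω => abs_nonneg _)
      (fun i => integral_abs_integral_le (hint i)) hdom)

end IntegralsOfProcesses

section PathVariance

variable {S Ω : Type*} [MeasurableSpace S] [MeasurableSpace Ω] {P : Measure S}
  [IsProbabilityMeasure P] {Q : Measure Ω} [IsProbabilityMeasure Q] {c : ℝ≥0 → ℝ → S → ℝ}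
  {B : ℝ≥0 → Ω → ℝ} {K t β ε u : ℝ}

theorem stronglyMeasurable_sigmaIntegrand (hc : IsBoundedField c K)
    (hBm : Measurable (Function.uncurry B)) (β : ℝ) :
    StronglyMeasurable (sigmaIntegrand P Q c B β) := by
  have hcorr := measurable_corr (P := P) hc.measurable
  by_cases h : β < 1 / 2
  · rw [show sigmaIntegrand P Q c B β = _ from funext fun u => if_pos h]
    exact (hcorr.comp (by fun_prop : Measurable fun u : ℝ =>
      (u.toNNReal, (0 : ℝ)))).stronglyMeasurable
  · rw [show sigmaIntegrand P Q c B β = _ from funext fun u => if_neg h]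
    have hpath : Measurable fun p : ℝ × Ω => (p.1.toNNReal, B p.1.toNNReal p.2) :=
      (by fun_prop : Measurable fun p : ℝ × Ω => p.1.toNNReal).prodMk
        (hBm.comp (by fun_prop : Measurable fun p : ℝ × Ω => (p.1.toNNReal, p.2)))
    exact (hcorr.comp hpath).stronglyMeasurable.integral_prod_right'

theorem abs_sigmaIntegrand_le (hc : IsBoundedField c K) (h0 : ∫ s, c 0 0 s ∂P = 0) (hu : 0 ≤ u) :
    |sigmaIntegrand P Q c B β u| ≤ 2 * K * K * alphaUm P c u := by
  unfold sigmaIntegrand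
  split_ifs
  · exact hc.abs_corr_le h0 hu _
  · exact abs_integral_le_of_abs_le_const fun ω => hc.abs_corr_le h0 hu _

theorem integrableOn_sigmaIntegrand (hc : IsBoundedField c K) (h0 : ∫ s, c 0 0 s ∂P = 0)
    (hα : IntegrableOn (alphaUm P c) (Ioi 0)) (hBm : Measurable (Function.uncurry B)) (β : ℝ) :
    IntegrableOn (sigmaIntegrand P Q c B β) (Ioi 0) := by
  refine (hα.const_mul (2 * K * K)).mono'
    (stronglyMeasurable_sigmaIntegrand hc hBm β).aestronglyMeasurable ?_
  filter_upwards [ae_restrict_mem measurableSet_Ioi] with u hu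
    using abs_sigmaIntegrand_le hc h0 (le_of_lt hu)

/-- The correlations of the field along a given Brownian path, integrated over the time and over all
positive lags: half of the asymptotic variance of the exponent. -/
noncomputable def pathVariance (P : Measure S) (c : ℝ≥0 → ℝ → S → ℝ) (B : ℝ≥0 → Ω → ℝ)
    (β t ε : ℝ) (ω : Ω) : ℝ :=
  ∫ r in (0 : ℝ)..t, ∫ u in Ioi (0 : ℝ), corr P c u.toNNReal (scaledIncrement B β ε r u ω)

theorem measurable_corr_scaledIncrement (hc : IsBoundedField c K)
    (hBm : Measurable (Function.uncurry B)) (β ε : ℝ) :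
    Measurable fun p : (ℝ × ℝ) × Ω =>
      corr P c p.1.2.toNNReal (scaledIncrement B β ε p.1.1 p.1.2 p.2) :=
  (measurable_corr hc.measurable).comp ((by fun_prop : Measurable fun p : (ℝ × ℝ) × Ω =>
    p.1.2.toNNReal).prodMk (measurable_scaledIncrement hBm β ε))

theorem integrable_prod_of_abs_le {f : ℝ × ℝ → ℝ} (hf : Measurable f) {g : ℝ → ℝ}
    (hg : IntegrableOn g (Ioi 0)) (hfg : ∀ r u, 0 ≤ u → |f (r, u)| ≤ g u) (t : ℝ) :
    Integrable f ((volume.restrict (Ioc 0 t)).prod (volume.restrict (Ioi 0))) := by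
  refine (hg.comp_snd _).mono' hf.aestronglyMeasurable ?_
  filter_upwards [Measure.quasiMeasurePreserving_snd.ae (ae_restrict_mem measurableSet_Ioi)]
    with p hp using hfg p.1 p.2 (le_of_lt hp)

theorem pathVariance_sub_eq (hc : IsBoundedField c K) (h0 : ∫ s, c 0 0 s ∂P = 0)
    (hα : IntegrableOn (alphaUm P c) (Ioi 0)) (hBm : Measurable (Function.uncurry B)) (ht : 0 ≤ t)
    (β ε : ℝ) (ω : Ω) :
    pathVariance P c B β t ε ω - t * sigmaConst P Q c B β =
      ∫ u in Ioi (0 : ℝ), primitive (fun r ω =>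
        corr P c u.toNNReal (scaledIncrement B β ε r u ω) - sigmaIntegrand P Q c B β u) t ω := by
  set ν := (volume.restrict (Ioc 0 t)).prod (volume.restrict (Ioi (0 : ℝ)))
  have hcorr : Integrable (fun p : ℝ × ℝ =>
      corr P c p.2.toNNReal (scaledIncrement B β ε p.1 p.2 ω)) ν :=
    integrable_prod_of_abs_le ((measurable_corr_scaledIncrement hc hBm β ε).comp
      measurable_prodMk_right) (hα.const_mul _) (fun _ _ hu => hc.abs_corr_le h0 hu _) t
  have hsigma : Integrable (fun p : ℝ × ℝ => sigmaIntegrand P Q c B β p.2) ν :=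
    (integrableOn_sigmaIntegrand hc h0 hα hBm β).comp_snd _
  have hpath : pathVariance P c B β t ε ω =
      ∫ p, corr P c p.2.toNNReal (scaledIncrement B β ε p.1 p.2 ω) ∂ν := by
    rw [integral_prod _ hcorr, pathVariance, intervalIntegral.integral_of_le ht]
  have hconst : t * sigmaConst P Q c B β = ∫ p, sigmaIntegrand P Q c B β p.2 ∂ν := by
    rw [integral_prod _ hsigma, sigmaConst]
    simp [ht]
  rw [hpath, hconst, ← integral_sub hcorr hsigma]
  refine (integral_prod_symm _ (hcorr.sub hsigma)).trans ?_
  simp only [primitive, intervalIntegral.integral_of_le ht, Pi.sub_apply]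

theorem abs_corr_sub_sigmaIntegrand_le (hc : IsBoundedField c K) (h0 : ∫ s, c 0 0 s ∂P = 0)
    (hu : 0 ≤ u) (y : ℝ) :
    |corr P c u.toNNReal y - sigmaIntegrand P Q c B β u| ≤ 2 * (2 * K * K * alphaUm P c u) := by
  rw [two_mul (2 * K * K * alphaUm P c u)]
  exact (abs_sub _ _).trans (add_le_add (hc.abs_corr_le h0 hu y) (abs_sigmaIntegrand_le hc h0 hu))

theorem measurable_primitive_corr_sub (hc : IsBoundedField c K)
    (hBm : Measurable (Function.uncurry B)) (ht : 0 ≤ t) (β ε : ℝ) :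
    Measurable (Function.uncurry fun u : ℝ => primitive (fun r ω =>
      corr P c u.toNNReal (scaledIncrement B β ε r u ω) - sigmaIntegrand P Q c B β u) t) := by
  have hcorr := (measurable_corr_scaledIncrement (P := P) hc hBm β ε).comp
    (by fun_prop : Measurable fun p : (ℝ × Ω) × ℝ => ((p.2, p.1.1), p.1.2))
  have hsigma := (stronglyMeasurable_sigmaIntegrand (P := P) (Q := Q) hc hBm β).measurable.comp
    (by fun_prop : Measurable fun p : (ℝ × Ω) × ℝ => p.1.1)
  simp only [Function.uncurry_def, primitive, intervalIntegral.integral_of_le ht]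
  exact ((hcorr.sub hsigma).stronglyMeasurable.integral_prod_right').measurable

theorem tendsto_integral_abs_primitive_corr_sub (hc : IsBoundedField c K) (hstat : Stationary P c)
    (h0 : ∫ s, c 0 0 s ∂P = 0) (hB : IsPreBrownianReal B Q)
    (hBm : Measurable (Function.uncurry B)) (hβ : β ≤ 1 / 2) (ht : 0 ≤ t) (hu : 0 ≤ u) :
    Tendsto (fun ε => ∫ ω, |primitive (fun r ω => corr P c u.toNNReal
      (scaledIncrement B β ε r u ω) - sigmaIntegrand P Q c B β u) t ω| ∂Q) (𝓝[>] 0) (𝓝 0) := by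
  have hcorr : Measurable (corr P c u.toNNReal) :=
    (measurable_corr hc.measurable).comp measurable_prodMk_left
  have hbound := abs_corr_sub_sigmaIntegrand_le (P := P) (Q := Q) (B := B) (β := β) hc h0 hu
  rcases hβ.lt_or_eq with hlt | rfl
  · refine tendsto_integral_abs_primitive_of_lt hB hBm hlt ht hu
      (f := fun y => corr P c u.toNNReal y - sigmaIntegrand P Q c B β u)
      (hcorr.sub_const _) hbound ?_
    have hcont := ((hstat.continuous_corr hc u.toNNReal).tendsto 0).sub_const
      (corr P c u.toNNReal 0)
    simpa only [sigmaIntegrand, if_pos hlt, sub_self] using hcont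
  · refine tendsto_integral_abs_primitive_half hB hBm ht hu
      (f := fun y => corr P c u.toNNReal y - sigmaIntegrand P Q c B (1 / 2) u)
      (hcorr.sub_const _) hbound ?_
    have hint : Integrable (fun ω => corr P c u.toNNReal (B u.toNNReal ω)) Q :=
      .of_bound (hcorr.comp_aemeasurable (hB.aemeasurable _)).aestronglyMeasurable _
        (Eventually.of_forall fun ω => hc.abs_corr_le h0 hu _)
    rw [integral_sub hint (integrable_const _), integral_const, probReal_univ, one_smul,
      sigmaIntegrand, if_neg (lt_irrefl _), sub_self]

theorem tendstoInMeasure_pathVariance (hc : IsBoundedField c K) (hstat : Stationary P c)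
    (h0 : ∫ s, c 0 0 s ∂P = 0) (hα : IntegrableOn (alphaUm P c) (Ioi 0))
    (hB : IsPreBrownianReal B Q) (hBm : Measurable (Function.uncurry B)) (hβ : β ≤ 1 / 2)
    (ht : 0 ≤ t) :
    TendstoInMeasure Q (pathVariance P c B β t) (𝓝[>] 0)
      (fun _ => t * sigmaConst P Q c B β) := by
  have hlim : TendstoInMeasure Q
      (fun ε ω => pathVariance P c B β t ε ω - t * sigmaConst P Q c B β) (𝓝[>] 0) 0 := by
    simp only [pathVariance_sub_eq hc h0 hα hBm ht]
    refine tendstoInMeasure_integral_zero (measurable_primitive_corr_sub hc hBm ht β)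
      (g := fun u => 2 * (2 * K * K * alphaUm P c u) * t)
      (((hα.const_mul _).const_mul 2).mul_const t) (fun ε => ?_) ?_
    · filter_upwards [ae_restrict_mem measurableSet_Ioi] with u hu ω
      have hproc := isBoundedProcess_comp_scaledIncrement hBm
        (f := fun y => corr P c u.toNNReal y - sigmaIntegrand P Q c B β u)
        (((measurable_corr hc.measurable).comp measurable_prodMk_left).sub_const _)
        (abs_corr_sub_sigmaIntegrand_le (P := P) (Q := Q) (B := B) (β := β) hc h0 (le_of_lt hu))
        β ε u
      simpa only [abs_of_nonneg ht] using hproc.abs_primitive_le t ω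
    · filter_upwards [ae_restrict_mem measurableSet_Ioi] with u hu
        using tendsto_integral_abs_primitive_corr_sub hc hstat h0 hB hBm hβ ht (le_of_lt hu)
  rw [tendstoInMeasure_iff_norm] at hlim ⊢
  simpa only [Pi.zero_apply, sub_zero] using hlim

end PathVariance

section MeasurableVersion

variable {T Ω E : Type*} [TopologicalSpace T] [TopologicalSpace.SeparableSpace T] [Nonempty T]
  [FrechetUrysohnSpace T] [MeasurableSpace Ω] {Q : Measure Ω} [TopologicalSpace E]
  [TopologicalSpace.PseudoMetrizableSpace E] [MeasurableSpace E] [BorelSpace E] {X : T → Ω → E}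

theorem measurable_of_continuous_of_measurable_denseSeq (hcont : ∀ ω, Continuous (X · ω))
    (hX : ∀ n, Measurable (X (TopologicalSpace.denseSeq T n))) (t : T) : Measurable (X t) := by
  obtain ⟨y, hy, hyt⟩ := mem_closure_iff_seq_limit.1 (TopologicalSpace.denseRange_denseSeq T t)
  refine measurable_of_tendsto_metrizable (f := fun k => X (y k)) (fun k => ?_)
    (tendsto_pi_nhds.2 fun ω => ((hcont ω).tendsto t).comp hyt)
  obtain ⟨n, hn⟩ := hy k
  exact hn ▸ hX n

theorem exists_continuous_measurable_version [Zero E] (hX : ∀ t, AEMeasurable (X t) Q)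
    (hcont : ∀ᵐ ω ∂Q, Continuous (X · ω)) :
    ∃ X' : T → Ω → E, (∀ ω, Continuous (X' · ω)) ∧ (∀ t, Measurable (X' t)) ∧
      ∀ᵐ ω ∂Q, ∀ t, X t ω = X' t ω := by
  set d := TopologicalSpace.denseSeq T with hd
  obtain ⟨G, hG, hGm, hgood⟩ :=
    (hcont.and (ae_all_iff.2 fun n => (hX (d n)).ae_eq_mk)).exists_measurable_mem
  have hcont' : ∀ ω, Continuous fun t => G.indicator (X t) ω := by
    intro ω
    by_cases hω : ω ∈ G
    · simpa only [indicator_of_mem hω] using (hgood ω hω).1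
    · simpa only [indicator_of_notMem hω] using continuous_const
  refine ⟨fun t => G.indicator (X t), hcont',
    measurable_of_continuous_of_measurable_denseSeq hcont' fun n => ?_, ?_⟩
  · rw [← hd, indicator_congr fun ω hω => (hgood ω hω).2 n]
    exact (hX (d n)).measurable_mk.indicator hGm
  · filter_upwards [hG] with ω hω t using (indicator_of_mem hω _).symm

end MeasurableVersion

section Exponent

variable {S Ω : Type*} {c : ℝ≥0 → ℝ → S → ℝ} {B : ℝ≥0 → Ω → ℝ} {β x ε K : ℝ} {ω : Ω}

/-- The path `r ↦ (x + B (ε r)) / ε ^ β` along which the exponent integrates the field, in the time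
scale of the field. -/
noncomputable def rescaledPath (B : ℝ≥0 → Ω → ℝ) (β x ε : ℝ) (ω : Ω) (r : ℝ) : ℝ :=
  (x + B (ε * r).toNNReal ω) / ε ^ β

theorem rescaledPath_add_sub (r u : ℝ) :
    rescaledPath B β x ε ω (r + u) - rescaledPath B β x ε ω r =
      scaledIncrement B β ε (ε * r) u ω := by
  simp only [rescaledPath, scaledIncrement, mul_add]
  ring

theorem exponent_eq_primitive (hε : 0 < ε) (t : ℝ≥0) (σ : S) :
    exponent c B β t x ε ω σ =
      primitive (fieldAlong c √ε (rescaledPath B β x ε ω)) (t / ε) σ := by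
  have hsubst := intervalIntegral.integral_comp_div (a := 0) (b := t)
    (fun r => c r.toNNReal (rescaledPath B β x ε ω r) σ) hε.ne'
  simp only [rescaledPath, mul_div_cancel₀ _ hε.ne', zero_div, smul_eq_mul] at hsubst
  simp only [exponent, primitive, fieldAlong, rescaledPath, intervalIntegral.integral_const_mul]
  rw [hsubst, ← mul_assoc, inv_mul_eq_div, Real.div_sqrt]

variable [MeasurableSpace S] {P : Measure S}

theorem integral_lagRate_fieldAlong (hstat : Stationary P c) (hc : IsBoundedField c K) (hε : 0 < ε)
    (t : ℝ≥0) :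
    ∫ r in 0..t / ε, lagRate P (fieldAlong c √ε (rescaledPath B β x ε ω)) r =
      pathVariance P c B β t ε ω := by
  have hrate : ∀ r ∈ uIcc 0 (t / ε), lagRate P (fieldAlong c √ε (rescaledPath B β x ε ω)) r =
      ε * ∫ u in Ioi (0 : ℝ), corr P c u.toNNReal (scaledIncrement B β ε (ε * r) u ω) := by
    intro r hr
    rw [uIcc_of_le (by positivity)] at hr
    rw [← integral_const_mul]
    refine setIntegral_congr_fun measurableSet_Ioi fun u hu => ?_
    simp only [hstat.lagCov_fieldAlong hc.measurable_apply _ _ hr.1 (le_of_lt hu),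
      Real.sq_sqrt hε.le, rescaledPath_add_sub]
  rw [intervalIntegral.integral_congr hrate, intervalIntegral.integral_const_mul,
    intervalIntegral.mul_integral_comp_mul_left (f := fun r =>
      ∫ u in Ioi (0 : ℝ), corr P c u.toNNReal (scaledIncrement B β ε r u ω)),
    mul_zero, mul_div_cancel₀ _ hε.ne', pathVariance]

variable [MeasurableSpace Ω]

theorem measurable_rescaledPath (hBm : Measurable (Function.uncurry B)) :
    Measurable (rescaledPath B β x ε ω) :=
  ((hBm.comp (by fun_prop : Measurable fun r : ℝ => ((ε * r).toNNReal, ω))).const_add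
    x).div_const _

variable [IsProbabilityMeasure P]

theorem abs_integral_exp_exponent_sub_le (hc : IsBoundedField c K) (hstat : Stationary P c)
    (hcentered : ∀ t x, ∫ s, c t x s ∂P = 0) (hα : IntegrableOn (alphaUm P c) (Ioi 0))
    (hBm : Measurable (Function.uncurry B)) (hε : 0 < ε) (t : ℝ≥0) :
    |∫ σ, Real.exp (exponent c B β t x ε ω σ) ∂P - Real.exp (pathVariance P c B β t ε ω)| ≤
      Real.exp (2 * (∫ u in Ioi (0 : ℝ), 2 * K * K * alphaUm P c u) * t) *
        comparisonError (√ε * K) (ε ^ (-(1 / 4) : ℝ)) (t / ε)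
          fun u => ε * (2 * K * K * alphaUm P c u) := by
  have hθ : (fun u => 2 * (√ε * K) * (√ε * K) * alphaUm P c u) =
      fun u => ε * (2 * K * K * alphaUm P c u) := by
    funext u
    linear_combination (2 * K * K * alphaUm P c u) * Real.mul_self_sqrt hε.le
  have h := (weaklyDependent_fieldAlong hc hcentered hα (Real.sqrt_nonneg ε)
    (measurable_rescaledPath hBm (β := β) (x := x) (ε := ε) (ω := ω))).abs_expMoment_sub_exp_le
    (Real.rpow_nonneg hε.le (-(1 / 4))) (by positivity : 0 ≤ t / ε)
  have hscale (C : ℝ) : 2 * (ε * C) * (t / ε) = 2 * C * t := by field_simp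
  rw [hθ, integral_const_mul, hscale, integral_lagRate_fieldAlong hstat hc hε] at h
  simpa only [exponent_eq_primitive hε, expMoment] using h

end Exponent

section Conclusion

theorem tendstoInMeasure_of_dist_le {Ω ι E : Type*} [MeasurableSpace Ω] {Q : Measure Ω}
    [PseudoMetricSpace E] {l : Filter ι} {f g : ι → Ω → E} {h : Ω → E} {η : ι → ℝ}
    (hη : Tendsto η l (𝓝 0)) (hfg : ∀ᶠ i in l, ∀ ω, dist (f i ω) (g i ω) ≤ η i)
    (hg : TendstoInMeasure Q g l h) : TendstoInMeasure Q f l h := by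
  rw [tendstoInMeasure_iff_dist] at hg ⊢
  intro δ hδ
  refine tendsto_of_tendsto_of_tendsto_of_le_of_le' tendsto_const_nhds (hg (δ / 2) (half_pos hδ))
    (Eventually.of_forall fun i => zero_le) ?_
  filter_upwards [hfg, hη.eventually (gt_mem_nhds (half_pos hδ))] with i hi hηi
  refine measure_mono fun ω (hω : δ ≤ dist (f i ω) (h ω)) => ?_
  change δ / 2 ≤ dist (g i ω) (h ω)
  linarith [dist_triangle (f i ω) (g i ω) (h ω), hi ω]

theorem tendstoInMeasure_comp_of_continuousAt {Ω ι E F : Type*} [MeasurableSpace Ω] {Q : Measure Ω}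
    [PseudoMetricSpace E] [PseudoMetricSpace F] {l : Filter ι} {f : ι → Ω → E} {m : E} {φ : E → F}
    (hφ : ContinuousAt φ m) (hf : TendstoInMeasure Q f l fun _ => m) :
    TendstoInMeasure Q (fun i ω => φ (f i ω)) l fun _ => φ m := by
  rw [tendstoInMeasure_iff_dist] at hf ⊢
  intro δ hδ
  obtain ⟨d, hd, hφd⟩ := Metric.continuousAt_iff.1 hφ δ hδ
  refine tendsto_of_tendsto_of_tendsto_of_le_of_le tendsto_const_nhds (hf d hd)
    (fun i => zero_le) fun i => measure_mono fun ω (hω : δ ≤ dist (φ (f i ω)) (φ m)) => ?_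
  exact not_lt.1 fun hlt => hω.not_gt (hφd hlt)

variable {S Ω : Type*} [MeasurableSpace S] [MeasurableSpace Ω] {P : Measure S}
  {Q : Measure Ω} {c : ℝ≥0 → ℝ → S → ℝ} {B B' : ℝ≥0 → Ω → ℝ} {K β : ℝ}

theorem sigmaIntegrand_congr (h : ∀ᵐ ω ∂Q, ∀ t, B t ω = B' t ω) :
    sigmaIntegrand P Q c B β = sigmaIntegrand P Q c B' β := by
  funext u
  refine if_congr Iff.rfl rfl (integral_congr_ae ?_)
  filter_upwards [h] with ω hω using congrArg (corr P c u.toNNReal) (hω _)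

theorem sigmaConst_congr (h : ∀ᵐ ω ∂Q, ∀ t, B t ω = B' t ω) :
    sigmaConst P Q c B β = sigmaConst P Q c B' β := by
  simp only [sigmaConst, sigmaIntegrand_congr h]

variable [IsProbabilityMeasure P]

theorem tendsto_comparisonError_alphaUm (hc : IsBoundedField c K)
    (hα : IntegrableOn (alphaUm P c) (Ioi 0)) (t : ℝ≥0) :
    Tendsto (fun ε => comparisonError (√ε * K) (ε ^ (-(1 / 4) : ℝ)) (t / ε)
      fun u => ε * (2 * K * K * alphaUm P c u)) (𝓝[>] 0) (𝓝 0) := by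
  have hK : 0 ≤ K := by
    have := nonempty_of_isProbabilityMeasure P
    exact hc.bound_nonneg
  refine tendsto_comparisonError (fun u _ => mul_nonneg (by positivity) (alphaUm_nonneg u))
    (hα.const_mul _) ?_ hK t.coe_nonneg
  simpa only [mul_zero] using (tendsto_atTop_zero_of_antitone_of_integrableOn antitone_alphaUm
    alphaUm_nonneg hα).const_mul (2 * K * K)

variable [IsProbabilityMeasure Q]

theorem tendstoInMeasure_integral_exp_exponent (hc : IsBoundedField c K) (hstat : Stationary P c)
    (hcentered : ∀ t x, ∫ s, c t x s ∂P = 0) (hα : IntegrableOn (alphaUm P c) (Ioi 0))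
    (hB : IsPreBrownianReal B Q) (hBm : Measurable (Function.uncurry B)) (hβ : β ≤ 1 / 2)
    (t : ℝ≥0) (x : ℝ) :
    TendstoInMeasure Q (fun ε ω => ∫ σ, Real.exp (exponent c B β t x ε ω σ) ∂P) (𝓝[>] 0)
      fun _ => Real.exp (t * sigmaConst P Q c B β) := by
  have herror := (tendsto_comparisonError_alphaUm hc hα t).const_mul
    (Real.exp (2 * (∫ u in Ioi (0 : ℝ), 2 * K * K * alphaUm P c u) * t))
  rw [mul_zero] at herror
  refine tendstoInMeasure_of_dist_le herror ?_
    (tendstoInMeasure_comp_of_continuousAt Real.continuous_exp.continuousAt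
      (tendstoInMeasure_pathVariance hc hstat (hcentered 0 0) hα hB hBm hβ t.coe_nonneg))
  filter_upwards [self_mem_nhdsWithin] with ε hε ω
    using abs_integral_exp_exponent_sub_le hc hstat hcentered hα hBm hε t

end Conclusion

end RandomPotential

theorem mainTheorem6_general {S Ω : Type*} [MeasurableSpace S] [MeasurableSpace Ω]
    (P : Measure S) [IsProbabilityMeasure P] (Q : Measure Ω) [IsProbabilityMeasure Q]
    (c : ℝ≥0 → ℝ → S → ℝ) (B : ℝ≥0 → Ω → ℝ)
    (hc_meas : Measurable (fun p : (ℝ≥0 × ℝ) × S => c p.1.1 p.1.2 p.2))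
    (hc_bdd : ∃ K : ℝ, ∀ t x s, |c t x s| ≤ K)
    (hc_stat : RandomPotential.Stationary P c)
    (hc_centered : ∀ t x, ∫ s, c t x s ∂P = 0)
    (hc_mix : IntegrableOn (RandomPotential.alphaUm P c) (Ioi (0 : ℝ)))
    (hB : IsBrownianReal B Q)
    (β : ℝ) (hβ : β ≤ 1 / 2) (t : ℝ≥0) (x : ℝ) :
    IntegrableOn (RandomPotential.sigmaIntegrand P Q c B β) (Ioi (0 : ℝ)) ∧
      TendstoInMeasure Q
        (fun (ε : ℝ) (ω : Ω) =>
          ∫ σ, Real.exp (RandomPotential.exponent c B β t x ε ω σ) ∂P)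
        (𝓝[>] 0)
        (fun _ => Real.exp (t * RandomPotential.sigmaConst P Q c B β)) := by
  obtain ⟨K, hK⟩ := hc_bdd
  have hc : RandomPotential.IsBoundedField c K := ⟨hc_meas, hK⟩
  obtain ⟨B', hcont, hmeas, hBB'⟩ :=
    RandomPotential.exists_continuous_measurable_version hB.aemeasurable hB.cont
  have hB' : IsPreBrownianReal B' Q :=
    hB.toIsPreBrownianReal.congr fun t => hBB'.mono fun ω hω => hω t
  have hB'm : Measurable (Function.uncurry B') :=
    measurable_uncurry_of_continuous_of_measurable hcont hmeas
  rw [RandomPotential.sigmaIntegrand_congr hBB', RandomPotential.sigmaConst_congr hBB']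
  refine ⟨RandomPotential.integrableOn_sigmaIntegrand hc (hc_centered 0 0) hc_mix hB'm β,
    (RandomPotential.tendstoInMeasure_integral_exp_exponent hc hc_stat hc_centered hc_mix hB' hB'm
      hβ t x).congr_left fun ε => ?_⟩
  filter_upwards [hBB'] with ω hω
  simp only [RandomPotential.exponent, hω]

theorem mainTheorem6 {S Ω : Type*} [MeasurableSpace S] [MeasurableSpace Ω]
    (P : Measure S) [IsProbabilityMeasure P] (Q : Measure Ω) [IsProbabilityMeasure Q]
    (c : ℝ≥0 → ℝ → S → ℝ) (B : ℝ≥0 → Ω → ℝ)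
    (hc_meas : Measurable (fun p : (ℝ≥0 × ℝ) × S => c p.1.1 p.1.2 p.2))
    (hc_bdd : ∃ K : ℝ, ∀ t x s, |c t x s| ≤ K)
    (hc_stat : RandomPotential.Stationary P c)
    (hc_centered : ∀ t x, ∫ s, c t x s ∂P = 0)
    (hc_mix : RandomPotential.HUm P c)
    (hB : IsBrownianReal B Q)
    (β : ℝ) (hβ0 : 0 ≤ β) (hβ : β ≤ 1 / 2) (t : ℝ≥0) (x : ℝ) :
    IntegrableOn (RandomPotential.sigmaIntegrand P Q c B β) (Ioi (0 : ℝ)) ∧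
      TendstoInMeasure Q
        (fun (ε : ℝ) (ω : Ω) =>
          ∫ σ, Real.exp (RandomPotential.exponent c B β t x ε ω σ) ∂P)
        (𝓝[>] 0)
        (fun _ => Real.exp (t * RandomPotential.sigmaConst P Q c B β)) :=
  mainTheorem6_general P Q c B hc_meas hc_bdd hc_stat hc_centered hc_mix.integrableOn_alphaUm hB β
    hβ t x
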